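/- Let $N\ge 2$ be an integer and $\alpha>-2$ a real number. Write $B_\rho\subset\mathbb{R}^N$ for the open ball of radius $\rho$ centred at $0$, put $A:=B_1\setminus\overline{B_{1/2}}$ and $$\|u\|_{H^1(A)}:=\Big(\int_A u^2\,dx+\int_A|\nabla u|^2\,dx\Big)^{1/2},\qquad \gamma(N,\alpha):=2-\frac N2+\frac\alpha2+\frac{\sqrt{(\alpha+2)(\alpha+2N-2)}}{2}.$$ Then there is a constant $C=C_{\alpha,N}>0$, depending only on $\alpha$ and $N$, with the following property. Let $f\in C^1(\mathbb{R})$ and let $u\in H^1(B_1)$ be radial (that is, almost everywhere equal to a function of $|x|$), a weak solution of $$-\Delta u=|x|^\alpha f(u)\quad\text{in } B_1\setminus\{0\},$$ that is, $|x|^\alpha f(u)\in L^1_{loc}(B_1\setminus\{0\})$ and $\int_{B_1}\nabla u\cdot\nabla\varphi\,dx=\int_{B_1}|x|^\alpha f(u)\varphi\,dx$ for all $\varphi\in C^1_c(B_1\setminus\{0\})$, and stable, that is, $|x|^\alpha f'(u)\in L^1_{loc}(B_1\setminus\{0\})$ and $$\int_{B_1}\big(|\nabla\varphi|^2-|x|^\alpha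 f'(u)\varphi^2\big)\,dx\ge 0\qquad\text{for all }\varphi\in C^1_c(B_1\setminus\{0\}).$$ Then there is a continuous function on $(0,1]$, again denoted by $u$, with $u(x)=u(|x|)$ for almost every $x\in B_1$, and: (i) if $N<10+4\alpha$, then $\|u\|_{L^\infty(B_1)}\le C\,\|u\|_{H^1(A)}$; (ii) if $N=10+4\alpha$, then $|u(r)|\le C\,\|u\|_{H^1(A)}\,(|\log r|+1)$ for all $r\in(0,1]$; (iii) if $N>10+4\alpha$, then $|u(r)|\le C\,\|u\|_{H^1(A)}\,r^{\gamma(N,\alpha)}$ for all $r\in(0,1]$. -/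

import Mathlib

open MeasureTheory Metric Set
open scoped ContDiff ENNReal Gradient

namespace HardyHenon

/-- `g` is a weak (distributional) gradient of `u` on the open set `U ⊆ ℝ^N`: both are locally
integrable on `U` and `∫_U u ∂_v φ = - ∫_U ⟨g, v⟩ φ` for every direction `v` and every
`φ ∈ C_c^∞(U)`. -/
structure HasWeakGradient {N : ℕ} (U : Set (EuclideanSpace ℝ (Fin N)))
    (u : EuclideanSpace ℝ (Fin N) → ℝ)
    (g : EuclideanSpace ℝ (Fin N) → EuclideanSpace ℝ (Fin N)) : Prop where
  locallyIntegrableOn : LocallyIntegrableOn u U volume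
  locallyIntegrableOn_grad : LocallyIntegrableOn g U volume
  integral_eq : ∀ (φ : EuclideanSpace ℝ (Fin N) → ℝ) (v : EuclideanSpace ℝ (Fin N)),
    ContDiff ℝ ∞ φ → HasCompactSupport φ → tsupport φ ⊆ U →
      ∫ x in U, u x * fderiv ℝ φ x v = - ∫ x in U, inner ℝ (g x) v * φ x

/-- Two weak gradients of the same function on an open set agree almost everywhere on that set. -/
theorem HasWeakGradient.ae_eq {N : ℕ} {U : Set (EuclideanSpace ℝ (Fin N))} (hU : IsOpen U)
    {u : EuclideanSpace ℝ (Fin N) → ℝ}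
    {g g' : EuclideanSpace ℝ (Fin N) → EuclideanSpace ℝ (Fin N)}
    (h : HasWeakGradient U u g) (h' : HasWeakGradient U u g') :
    ∀ᵐ x ∂(volume.restrict U), g x = g' x := by
  rw [ae_restrict_iff' hU.measurableSet]
  have key : ∀ᵐ x ∂(volume : Measure (EuclideanSpace ℝ (Fin N))), x ∈ U → (g - g') x = 0 := by
    refine hU.ae_eq_zero_of_integral_contDiff_smul_eq_zero
      (h.locallyIntegrableOn_grad.sub h'.locallyIntegrableOn_grad) ?_
    intro φ hφ hc hs
    have hint : ∀ k : EuclideanSpace ℝ (Fin N) → EuclideanSpace ℝ (Fin N),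
        LocallyIntegrableOn k U volume → Integrable (fun x => φ x • k x) volume := by
      intro k hk
      have h1 : IntegrableOn (fun x => φ x • k x) (tsupport φ) volume :=
        (hk.integrableOn_compact_subset hs hc).continuousOn_smul hφ.continuous.continuousOn hc
      refine (integrableOn_iff_integrable_of_support_subset ?_).1 h1
      intro x hx
      refine subset_tsupport φ ?_
      intro h0
      exact hx (by simp [h0])
    have hig := hint g h.locallyIntegrableOn_grad
    have hig' := hint g' h'.locallyIntegrableOn_grad
    have hrestr : ∀ (k : EuclideanSpace ℝ (Fin N) → EuclideanSpace ℝ (Fin N))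
        (v : EuclideanSpace ℝ (Fin N)),
        ∫ x in U, inner ℝ (k x) v * φ x = ∫ x, inner ℝ v (φ x • k x) := by
      intro k v
      rw [setIntegral_eq_integral_of_forall_compl_eq_zero]
      · refine integral_congr_ae (Filter.Eventually.of_forall fun x => ?_)
        simp only [inner_smul_right, real_inner_comm v (k x)]
        ring
      · intro x hx
        have h0 : φ x = 0 := image_eq_zero_of_notMem_tsupport fun hx' => hx (hs hx')
        simp [h0]
    have heq : ∫ x, φ x • g x = ∫ x, φ x • g' x := by
      refine ext_inner_left ℝ fun v => ?_
      rw [← integral_inner hig, ← integral_inner hig', ← hrestr, ← hrestr]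
      have e1 := h.integral_eq φ v hφ hc hs
      have e2 := h'.integral_eq φ v hφ hc hs
      linarith
    simp only [Pi.sub_apply, smul_sub]
    rw [integral_sub hig hig', heq, sub_self]
  filter_upwards [key] with x hx hxU
  simpa [sub_eq_zero] using hx hxU

/-- The weak gradient of `u` on `U` (a chosen representative, unique up to null sets when `U` is
open; only used for functions that have one). -/
noncomputable def weakGradient {N : ℕ} (U : Set (EuclideanSpace ℝ (Fin N)))
    (u : EuclideanSpace ℝ (Fin N) → ℝ) : EuclideanSpace ℝ (Fin N) → EuclideanSpace ℝ (Fin N) :=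
  Classical.epsilon (HasWeakGradient U u)

/-- `u ∈ H¹(U)`: `u ∈ L²(U)` and `u` has a weak gradient on `U` that lies in `L²(U)`. -/
def MemH1 {N : ℕ} (U : Set (EuclideanSpace ℝ (Fin N)))
    (u : EuclideanSpace ℝ (Fin N) → ℝ) : Prop :=
  MemLp u 2 (volume.restrict U) ∧
    ∃ g, HasWeakGradient U u g ∧ MemLp g 2 (volume.restrict U)

/-- `‖u‖_{H¹(U)} = (∫_U u² + ∫_U |∇u|²)^{1/2}`. -/
noncomputable def h1Norm {N : ℕ} (U : Set (EuclideanSpace ℝ (Fin N)))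
    (u : EuclideanSpace ℝ (Fin N) → ℝ) : ℝ :=
  √((∫ x in U, u x ^ 2) + ∫ x in U, ‖weakGradient U u x‖ ^ 2)

/-- The unit ball `B₁` of `ℝ^N`. -/
abbrev unitBall (N : ℕ) : Set (EuclideanSpace ℝ (Fin N)) := ball 0 1

/-- The annulus `B₁ ∖ closure B_{1/2}` of `ℝ^N`. -/
abbrev annulus (N : ℕ) : Set (EuclideanSpace ℝ (Fin N)) := ball 0 1 \ closedBall 0 (1 / 2)

/-- `u` is radial on `B₁`, as an almost everywhere defined function. -/
def IsRadial {N : ℕ} (u : EuclideanSpace ℝ (Fin N) → ℝ) : Prop :=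
  ∃ w : ℝ → ℝ, ∀ᵐ x ∂(volume.restrict (unitBall N)), u x = w ‖x‖

/-- `φ ∈ C¹` with compact support contained in `B₁ ∖ {0}`. -/
structure IsTest {N : ℕ} (φ : EuclideanSpace ℝ (Fin N) → ℝ) : Prop where
  contDiff : ContDiff ℝ 1 φ
  hasCompactSupport : HasCompactSupport φ
  tsupport_subset : tsupport φ ⊆ unitBall N \ {0}

/-- `u` is a weak solution of `-Δu = |x|^α f(u)` in `B₁ ∖ {0}`: `|x|^α f(u) ∈ L¹_loc(B₁ ∖ {0})` and
`∫ ∇u · ∇φ = ∫ |x|^α f(u) φ` for all `φ ∈ C¹_c(B₁ ∖ {0})`. -/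
def IsWeakSolution {N : ℕ} (α : ℝ) (f : ℝ → ℝ) (u : EuclideanSpace ℝ (Fin N) → ℝ) : Prop :=
  LocallyIntegrableOn (fun x => ‖x‖ ^ α * f (u x)) (unitBall N \ {0}) volume ∧
    ∀ φ : EuclideanSpace ℝ (Fin N) → ℝ, IsTest φ →
      ∫ x in unitBall N, inner ℝ (weakGradient (unitBall N) u x) (∇ φ x) =
        ∫ x in unitBall N, ‖x‖ ^ α * f (u x) * φ x

/-- `u` is stable: `|x|^α f'(u) ∈ L¹_loc(B₁ ∖ {0})` and the second variation
`∫ (|∇φ|² - |x|^α f'(u) φ²)` is nonnegative for all `φ ∈ C¹_c(B₁ ∖ {0})`. -/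
def IsStable {N : ℕ} (α : ℝ) (f : ℝ → ℝ) (u : EuclideanSpace ℝ (Fin N) → ℝ) : Prop :=
  LocallyIntegrableOn (fun x => ‖x‖ ^ α * deriv f (u x)) (unitBall N \ {0}) volume ∧
    ∀ φ : EuclideanSpace ℝ (Fin N) → ℝ, IsTest φ →
      0 ≤ ∫ x in unitBall N, (‖∇ φ x‖ ^ 2 - ‖x‖ ^ α * deriv f (u x) * φ x ^ 2)

/-- The exponent `γ(N, α) = 2 - N/2 + α/2 + √((α + 2)(α + 2N - 2)) / 2`. -/
noncomputable def gammaExp (N : ℕ) (α : ℝ) : ℝ :=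
  2 - (N : ℝ) / 2 + α / 2 + √((α + 2) * (α + 2 * (N : ℝ) - 2)) / 2

end HardyHenon

/-! A radial `H¹` function is an absolutely continuous function `w` of `r = |x|`, and the weak
equation, tested with radial functions, makes it a classical solution of `-w'' - (N - 1) w' / r = r
^ α f(w)` on `(0, 1)` (`exists_isRadialSolution`).

The estimate comes from stability alone, with `f` eliminated. Set `q = r ^ (-α / 2) w'`.
Differentiating the equation gives `q'' + (N - 1) q' / r + r ^ α f'(w) q = b² q / r²` with `b² = (α
+ 2)(α + 2N - 2) / 4`: the power of `r` is exactly the one for which the undifferentiated `f(w)`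
cancels. Inserting `q η` into the second variation therefore leaves the Hardy type inequality `∫ r ^
(N - 1) q² (η'² - b² η² / r²) ≥ 0` (`IsRadialSolution.integral_nonneg_of_stable`).

For `η = r ^ (-b)` the integrand vanishes identically. So `η` is taken to be `r ^ (-b)` beyond a
radius `R`, bent smoothly into a multiple of `r ^ (1 + α / 2)` below `R`, and cut off near `0` and
near `1`. The form is then at most `-c R ^ (-2b - 2)` on `(R / 2, R)`, nonpositive elsewhere away
from the cutoffs, bounded on `(1/2, 1)`, and the cutoff at `0` costs nothing in the limit because
`w` has finite energy. This gives `∫_{R/2}^R r ^ (N - 1) w'² ≤ C R ^ (2b + 2 + α) ∫_{1/2}^1 r ^ (N -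
1) w'²` (`exists_energy_decay`).

By Cauchy-Schwarz the oscillation of `w` on `[R / 2, R]` is at most `C ‖u‖ R ^ γ`
(`exists_oscillation_bound`), while `|w| ≤ C ‖u‖` on `[1/2, 1]` by the one-dimensional Sobolev
inequality. Summing over dyadic scales (`abs_le_mul_of_dyadic`) gives a convergent geometric series,
a logarithm or a power, according to the sign of `γ`, which is that of `10 + 4α - N`. -/

namespace HardyHenon

/-! ### Polar coordinates and spherical means. -/

section Polar

variable {E : Type*} [NormedAddCommGroup E] [NormedSpace ℝ E]

/-- Polar coordinates `(σ, r) ↦ r σ`. -/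
def polarMap (p : sphere (0 : E) 1 × ℝ) : E := p.2 • (p.1 : E)

/-- The measure `r ^ n dr` on the set `s` of radii. -/
noncomputable def powMeasure (n : ℕ) (s : Set ℝ) : Measure ℝ :=
  (volume.restrict s).withDensity fun r => ENNReal.ofReal (r ^ n)

theorem powMeasure_restrict (n : ℕ) {s t : Set ℝ} (ht : MeasurableSet t) :
    (powMeasure n s).restrict t = powMeasure n (t ∩ s) := by
  rw [powMeasure, restrict_withDensity ht, Measure.restrict_restrict ht, powMeasure]

instance (n : ℕ) (s : Set ℝ) : SigmaFinite (powMeasure n s) := by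
  unfold powMeasure
  exact SigmaFinite.withDensity_of_ne_top (by simp)

theorem integral_powMeasure (n : ℕ) {s : Set ℝ} (hs : MeasurableSet s) (h0 : s ⊆ Ioi 0)
    (F : ℝ → ℝ) : ∫ r, F r ∂(powMeasure n s) = ∫ r in s, r ^ n * F r := by
  have : powMeasure n s
      = (volume.restrict s).withDensity fun r => ((Real.toNNReal (r ^ n) : NNReal) : ℝ≥0∞) := rfl
  rw [this, integral_withDensity_eq_integral_smul (by fun_prop)]
  refine setIntegral_congr_fun hs fun r hr => ?_
  simp only [NNReal.smul_def, smul_eq_mul]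
  rw [Real.coe_toNNReal _ (pow_nonneg (h0 hr).le _)]

theorem integrable_powMeasure (n : ℕ) {s : Set ℝ} (hs : MeasurableSet s) (h0 : s ⊆ Ioi 0)
    (F : ℝ → ℝ) : Integrable F (powMeasure n s) ↔ IntegrableOn (fun r => r ^ n * F r) s := by
  have : powMeasure n s
      = (volume.restrict s).withDensity fun r => ((Real.toNNReal (r ^ n) : NNReal) : ℝ≥0∞) := rfl
  rw [this, integrable_withDensity_iff_integrable_smul (by fun_prop)]
  refine integrableOn_congr_fun (fun r hr => ?_) hs
  simp only [NNReal.smul_def, smul_eq_mul]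
  rw [Real.coe_toNNReal _ (pow_nonneg (h0 hr).le _)]

theorem ae_powMeasure (n : ℕ) {s : Set ℝ} (hs : MeasurableSet s) (h0 : s ⊆ Ioi 0)
    {P : ℝ → Prop} : (∀ᵐ r ∂(powMeasure n s), P r) ↔ ∀ᵐ r ∂(volume.restrict s), P r := by
  rw [powMeasure, ae_withDensity_iff (by fun_prop)]
  refine Filter.eventually_congr ?_
  filter_upwards [ae_restrict_mem hs] with r hr
  have : 0 < r ^ n := pow_pos (h0 hr) _
  simp [this]

variable [MeasurableSpace E] [BorelSpace E]

theorem measurable_polarMap [FiniteDimensional ℝ E] :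
    Measurable (polarMap : sphere (0 : E) 1 × ℝ → E) := by
  unfold polarMap
  exact (Continuous.measurable (by fun_prop))

theorem map_val_volumeIoiPow (n : ℕ) :
    (Measure.volumeIoiPow n).map Subtype.val = powMeasure n (Ioi 0) := by
  ext t ht
  rw [Measure.map_apply measurable_subtype_coe ht, Measure.volumeIoiPow, powMeasure,
    withDensity_apply _ (measurable_subtype_coe ht), withDensity_apply _ ht,
    Measure.restrict_restrict ht, setLIntegral_subtype measurableSet_Ioi _
      fun a : ℝ ↦ ENNReal.ofReal (a ^ n)]
  congr 2
  ext x
  simp [and_comm]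

variable [FiniteDimensional ℝ E] (μ : Measure E) [μ.IsAddHaarMeasure]

/-- The homeomorphism of the punctured space with sphere times half-line preserves measure, and the
origin is null; the radius is moved from the subtype to `ℝ` so that later integrals run over sets of
reals. -/
theorem measurePreserving_polarMap [Nontrivial E] :
    MeasurePreserving polarMap (μ.toSphere.prod (powMeasure (Module.finrank ℝ E - 1) (Ioi 0)))
      μ := by
  refine ⟨measurable_polarMap, ?_⟩
  have h1 := (μ.measurePreserving_homeomorphUnitSphereProd).symm
    (homeomorphUnitSphereProd E).toMeasurableEquiv
  have h2 : MeasurePreserving (Prod.map id Subtype.val)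
      (μ.toSphere.prod (Measure.volumeIoiPow (Module.finrank ℝ E - 1)))
      (μ.toSphere.prod (powMeasure (Module.finrank ℝ E - 1) (Ioi 0))) :=
    (MeasurePreserving.id _).prod ⟨measurable_subtype_coe, map_val_volumeIoiPow _⟩
  have h3 : MeasurePreserving (Subtype.val : ({0}ᶜ : Set E) → E) (μ.comap (↑)) μ := by
    refine ⟨measurable_subtype_coe, ?_⟩
    rw [map_comap_subtype_coe (measurableSet_singleton _).compl, restrict_compl_singleton]
  have h4 := (h3.comp h1).map_eq
  rw [← h2.map_eq, Measure.map_map measurable_polarMap h2.measurable]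
  exact h4

theorem measurePreserving_polarMap_restrict [Nontrivial E] {s : Set ℝ} (hs : MeasurableSet s)
    (h0 : s ⊆ Ioi 0) :
    MeasurePreserving polarMap (μ.toSphere.prod (powMeasure (Module.finrank ℝ E - 1) s))
      (μ.restrict {x | ‖x‖ ∈ s}) := by
  have h := (measurePreserving_polarMap μ).restrict_preimage (s := {x | ‖x‖ ∈ s})
    (measurable_norm hs)
  have h2 : (μ.toSphere.prod (powMeasure (Module.finrank ℝ E - 1) (Ioi 0))).restrict
      (polarMap ⁻¹' {x | ‖x‖ ∈ s}) = μ.toSphere.prod (powMeasure (Module.finrank ℝ E - 1) s) := by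
    have e : (polarMap ⁻¹' {x : E | ‖x‖ ∈ s}) = univ ×ˢ {r | |r| ∈ s} := by
      ext ⟨σ, r⟩
      simp [polarMap, norm_smul]
    have hm : MeasurableSet {r : ℝ | |r| ∈ s} := measurable_abs hs
    rw [e, ← Measure.prod_restrict, Measure.restrict_univ, powMeasure_restrict _ hm]
    congr 2
    ext r
    constructor
    · rintro ⟨h1, h2⟩
      simpa [abs_of_pos (show 0 < r from h2)] using h1
    · intro h
      have : 0 < r := h0 h
      exact ⟨by simpa [abs_of_pos this] using h, this⟩
  rwa [h2] at h

/-- The average of `h` over the sphere of radius `r`. -/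
noncomputable def sphericalMean (h : E → ℝ) (r : ℝ) : ℝ := ⨍ σ, h (r • (σ : E)) ∂μ.toSphere

variable [Nontrivial E] {s : Set ℝ}

/-- Fubini in polar coordinates: since the sphere has nonzero measure, almost every radius has a
good direction, and the direction does not affect `P`. -/
theorem ae_norm_iff (hs : MeasurableSet s) (h0 : s ⊆ Ioi 0) {P : ℝ → Prop} :
    (∀ᵐ x ∂(μ.restrict {x | ‖x‖ ∈ s}), P ‖x‖) ↔ ∀ᵐ r ∂(volume.restrict s), P r := by
  rw [← ae_powMeasure (Module.finrank ℝ E - 1) hs h0]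
  have hΦ := measurePreserving_polarMap_restrict μ hs h0
  have hpos : ∀ᵐ r ∂(powMeasure (Module.finrank ℝ E - 1) s), 0 < r := by
    rw [ae_powMeasure _ hs h0]
    filter_upwards [ae_restrict_mem hs] with r hr using h0 hr
  constructor
  · intro h
    have h1 := hΦ.quasiMeasurePreserving.ae h
    have h2 : ∀ᵐ z ∂((powMeasure (Module.finrank ℝ E - 1) s).prod μ.toSphere),
        P ‖z.1 • (z.2 : E)‖ := by
      have := Measure.measurePreserving_swap (μ := powMeasure (Module.finrank ℝ E - 1) s)
        (ν := μ.toSphere)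
      exact this.quasiMeasurePreserving.ae h1
    have h3 := Measure.ae_ae_of_ae_prod h2
    filter_upwards [h3, hpos] with r hr hr0
    have : NeZero μ.toSphere := ⟨Measure.toSphere_ne_zero μ⟩
    obtain ⟨σ, hσ⟩ := hr.exists
    simpa [norm_smul, abs_of_pos hr0] using hσ
  · intro h
    -- `P` need not be measurable, so it is replaced by a measurable conull set on which it holds.
    obtain ⟨T, hT, hTm, hTP⟩ := h.exists_measurable_mem
    have h1 : ∀ᵐ z ∂(μ.toSphere.prod (powMeasure (Module.finrank ℝ E - 1) s)),
        ‖polarMap z‖ ∈ T := by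
      have h2 : ∀ᵐ z ∂(μ.toSphere.prod (powMeasure (Module.finrank ℝ E - 1) s)),
          z.2 ∈ T ∧ 0 < z.2 :=
        Measure.quasiMeasurePreserving_snd.ae (Filter.Eventually.and hT hpos)
      filter_upwards [h2] with z hz
      simpa [polarMap, norm_smul, abs_of_pos hz.2] using hz.1
    rw [← hΦ.map_eq]
    have h3 : ∀ᵐ x ∂(Measure.map polarMap (μ.toSphere.prod
        (powMeasure (Module.finrank ℝ E - 1) s))), ‖x‖ ∈ T :=
      (ae_map_iff measurable_polarMap.aemeasurable (measurable_norm hTm)).2 h1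
    filter_upwards [h3] with x hx using hTP _ hx

theorem sphericalMean_of_radial (hs : MeasurableSet s) (h0 : s ⊆ Ioi 0) {h : E → ℝ} {w : ℝ → ℝ}
    (hw : ∀ᵐ x ∂(μ.restrict {x | ‖x‖ ∈ s}), h x = w ‖x‖) :
    ∀ᵐ r ∂(volume.restrict s), sphericalMean μ h r = w r := by
  rw [← ae_powMeasure (Module.finrank ℝ E - 1) hs h0]
  have hpos : ∀ᵐ r ∂(powMeasure (Module.finrank ℝ E - 1) s), 0 < r := by
    rw [ae_powMeasure _ hs h0]
    filter_upwards [ae_restrict_mem hs] with r hr using h0 hr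
  have hΦ := measurePreserving_polarMap_restrict μ hs h0
  have h1 := hΦ.quasiMeasurePreserving.ae hw
  have h2 := Measure.ae_ae_of_ae_prod ((Measure.measurePreserving_swap
    (μ := powMeasure (Module.finrank ℝ E - 1) s)
    (ν := μ.toSphere)).quasiMeasurePreserving.ae h1)
  have : NeZero μ.toSphere := ⟨Measure.toSphere_ne_zero μ⟩
  filter_upwards [h2, hpos] with r hr hr0
  have h3 : (fun σ : sphere (0 : E) 1 => h (r • (σ : E))) =ᵐ[μ.toSphere] fun _ => w r := by
    filter_upwards [hr] with σ hσ
    simpa [polarMap, norm_smul, abs_of_pos hr0] using hσ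
  rw [sphericalMean, average_congr h3, average_const]

/-- The area of the unit sphere. -/
noncomputable def sphereArea : ℝ := μ.toSphere.real univ

theorem sphereArea_pos : 0 < sphereArea μ := by
  have : NeZero μ.toSphere := ⟨Measure.toSphere_ne_zero μ⟩
  exact measureReal_univ_pos

theorem sphereArea_mul_sphericalMean (h : E → ℝ) (r : ℝ) :
    sphereArea μ * sphericalMean μ h r = ∫ σ, h (r • (σ : E)) ∂μ.toSphere := by
  rw [sphericalMean, sphereArea, average_eq, smul_eq_mul, mul_inv_cancel_left₀]
  exact (sphereArea_pos μ).ne'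

theorem integrable_comp_polarMap (hs : MeasurableSet s) (h0 : s ⊆ Ioi 0) {h : E → ℝ}
    (hh : IntegrableOn h {x | ‖x‖ ∈ s} μ) :
    Integrable (fun z => h (polarMap z))
      (μ.toSphere.prod (powMeasure (Module.finrank ℝ E - 1) s)) :=
  (measurePreserving_polarMap_restrict μ hs h0).integrable_comp_of_integrable hh

theorem ae_integrable_sphere (hs : MeasurableSet s) (h0 : s ⊆ Ioi 0) {h : E → ℝ}
    (hh : IntegrableOn h {x | ‖x‖ ∈ s} μ) :
    ∀ᵐ r ∂(volume.restrict s),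
      Integrable (fun σ : sphere (0 : E) 1 => h (r • (σ : E))) μ.toSphere := by
  rw [← ae_powMeasure (Module.finrank ℝ E - 1) hs h0]
  exact (integrable_comp_polarMap μ hs h0 hh).prod_left_ae

theorem integrableOn_sphericalMean (hs : MeasurableSet s) (h0 : s ⊆ Ioi 0) {h : E → ℝ}
    (hh : IntegrableOn h {x | ‖x‖ ∈ s} μ) :
    IntegrableOn (fun r => r ^ (Module.finrank ℝ E - 1) * sphericalMean μ h r) s := by
  rw [← integrable_powMeasure _ hs h0]
  have h1 := (integrable_comp_polarMap μ hs h0 hh).integral_prod_right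
  refine (h1.const_mul (sphereArea μ)⁻¹).congr ?_
  filter_upwards with r
  simp only [polarMap]
  rw [← sphereArea_mul_sphericalMean, inv_mul_cancel_left₀ (sphereArea_pos μ).ne']

theorem integral_mul_radial (hs : MeasurableSet s) (h0 : s ⊆ Ioi 0) {h : E → ℝ} {F : ℝ → ℝ}
    (hh : IntegrableOn (fun x => h x * F ‖x‖) {x | ‖x‖ ∈ s} μ) :
    ∫ x in {x | ‖x‖ ∈ s}, h x * F ‖x‖ ∂μ =
      sphereArea μ * ∫ r in s, r ^ (Module.finrank ℝ E - 1) * (sphericalMean μ h r * F r) := by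
  have hΦ := measurePreserving_polarMap_restrict μ hs h0
  have h1 := integral_map (μ := μ.toSphere.prod (powMeasure (Module.finrank ℝ E - 1) s))
    (φ := polarMap) measurable_polarMap.aemeasurable
    (f := fun x => h x * F ‖x‖) (by rw [hΦ.map_eq]; exact hh.aestronglyMeasurable)
  rw [hΦ.map_eq] at h1
  rw [h1, integral_prod_symm _ (integrable_comp_polarMap μ hs h0 hh),
    ← integral_powMeasure _ hs h0, ← integral_const_mul]
  have hpos : ∀ᵐ r ∂(powMeasure (Module.finrank ℝ E - 1) s), 0 < r := by
    rw [ae_powMeasure _ hs h0]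
    filter_upwards [ae_restrict_mem hs] with r hr using h0 hr
  refine integral_congr_ae ?_
  filter_upwards [hpos] with r hr
  rw [← mul_assoc, sphereArea_mul_sphericalMean, ← integral_mul_const]
  simp [polarMap, norm_smul, abs_of_pos hr]

/-- In contrast with `integral_mul_radial`, no integrability is needed, so this applies directly to
the nonlinear terms of the equation and of the second variation. -/
theorem integral_radial (hs : MeasurableSet s) (h0 : s ⊆ Ioi 0) (F : ℝ → ℝ) :
    ∫ x in {x | ‖x‖ ∈ s}, F ‖x‖ ∂μ =
      sphereArea μ * ∫ r in s, r ^ (Module.finrank ℝ E - 1) * F r := by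
  have hm : MeasurableSet {x : E | ‖x‖ ∈ s} := measurable_norm hs
  have h1 := integral_fun_norm_addHaar μ (s.indicator F)
  have h2 : ∀ x : E, s.indicator F ‖x‖ = {x : E | ‖x‖ ∈ s}.indicator (fun x => F ‖x‖) x :=
    fun x => by simp [indicator]
  simp only [h2, integral_indicator hm] at h1
  rw [h1, sphereArea, Measure.toSphere_real_apply_univ, nsmul_eq_mul, smul_eq_mul, mul_assoc]
  congr 2
  have h3 : ∀ r, r ^ (Module.finrank ℝ E - 1) • s.indicator F r
      = s.indicator (fun r => r ^ (Module.finrank ℝ E - 1) * F r) r := fun r => by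
    by_cases hr : r ∈ s <;> simp [hr]
  simp only [h3]
  rw [setIntegral_indicator hs, inter_eq_right.2 h0]

/-- Jensen's inequality on each sphere. -/
theorem sq_sphericalMean_le (hs : MeasurableSet s) (h0 : s ⊆ Ioi 0) {h : E → ℝ}
    (hh : IntegrableOn h {x | ‖x‖ ∈ s} μ) (hh2 : IntegrableOn (fun x => h x ^ 2) {x | ‖x‖ ∈ s} μ) :
    ∀ᵐ r ∂(volume.restrict s),
      sphericalMean μ h r ^ 2 ≤ sphericalMean μ (fun x => h x ^ 2) r := by
  have : NeZero μ.toSphere := ⟨Measure.toSphere_ne_zero μ⟩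
  filter_upwards [ae_integrable_sphere μ hs h0 hh, ae_integrable_sphere μ hs h0 hh2] with r h1 h2
  exact ConvexOn.map_average_le (g := fun x : ℝ => x ^ 2) even_two.convexOn_pow (by fun_prop)
    isClosed_univ (by simp) h1 h2

theorem integrableOn_sq_sphericalMean (hs : MeasurableSet s) (h0 : s ⊆ Ioi 0) {h : E → ℝ}
    (hh : IntegrableOn h {x | ‖x‖ ∈ s} μ) (hh2 : IntegrableOn (fun x => h x ^ 2) {x | ‖x‖ ∈ s} μ) :
    IntegrableOn (fun r => r ^ (Module.finrank ℝ E - 1) * sphericalMean μ h r ^ 2) s := by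
  have h1 := integrableOn_sphericalMean μ hs h0 hh
  have hm : AEStronglyMeasurable (fun r => sphericalMean μ h r) (volume.restrict s) := by
    have := h1.aestronglyMeasurable.mul
      (show AEStronglyMeasurable (fun r : ℝ => (r ^ (Module.finrank ℝ E - 1))⁻¹)
        (volume.restrict s) from (Measurable.aestronglyMeasurable (by fun_prop)))
    refine this.congr ?_
    filter_upwards [ae_restrict_mem hs] with r hr
    have : r ^ (Module.finrank ℝ E - 1) ≠ 0 := pow_ne_zero _ (ne_of_gt (h0 hr))
    simp only [Pi.mul_apply]
    field_simp
  refine (integrableOn_sphericalMean μ hs h0 hh2).mono' ?_ ?_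
  · exact (Measurable.aestronglyMeasurable (by fun_prop)).mul (hm.pow 2)
  · filter_upwards [sq_sphericalMean_le μ hs h0 hh hh2, ae_restrict_mem hs] with r hr hrs
    have : 0 ≤ r ^ (Module.finrank ℝ E - 1) := pow_nonneg (le_of_lt (h0 hrs)) _
    rw [Real.norm_of_nonneg (by positivity)]
    exact mul_le_mul_of_nonneg_left hr this

theorem integral_sq_sphericalMean_le (hs : MeasurableSet s) (h0 : s ⊆ Ioi 0) {h : E → ℝ}
    (hh : IntegrableOn h {x | ‖x‖ ∈ s} μ) (hh2 : IntegrableOn (fun x => h x ^ 2) {x | ‖x‖ ∈ s} μ) :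
    sphereArea μ * ∫ r in s, r ^ (Module.finrank ℝ E - 1) * sphericalMean μ h r ^ 2 ≤
      ∫ x in {x | ‖x‖ ∈ s}, h x ^ 2 ∂μ := by
  have e := integral_mul_radial μ hs h0 (h := fun x => h x ^ 2) (F := fun _ => 1)
    (by simpa using hh2)
  simp only [mul_one] at e
  rw [e]
  refine mul_le_mul_of_nonneg_left ?_ (sphereArea_pos μ).le
  refine integral_mono_ae (integrableOn_sq_sphericalMean μ hs h0 hh hh2)
    (integrableOn_sphericalMean μ hs h0 hh2) ?_
  filter_upwards [sq_sphericalMean_le μ hs h0 hh hh2, ae_restrict_mem hs] with r hr hrs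
  exact mul_le_mul_of_nonneg_left hr (pow_nonneg (le_of_lt (h0 hrs)) _)

end Polar

/-! ### Weak derivatives and primitives on the interval `(0, 1)`. -/

theorem exists_Icc_of_isCompact {K : Set ℝ} (hK : IsCompact K) (h : K ⊆ Ioo 0 1) :
    ∃ a b : ℝ, 0 < a ∧ a < 1 / 2 ∧ 1 / 2 < b ∧ b < 1 ∧ K ⊆ Icc a b := by
  -- Adding `1 / 2` covers the case of empty `K` and puts the base point of all primitives inside
  -- `[a, b]`.
  have hK' : IsCompact (insert (1 / 2 : ℝ) K) := hK.insert _
  have hne : (insert (1 / 2 : ℝ) K).Nonempty := insert_nonempty _ _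
  have hsub : insert (1 / 2 : ℝ) K ⊆ Ioo 0 1 :=
    insert_subset (by constructor <;> norm_num) h
  obtain ⟨a, ha, ha'⟩ := hK'.exists_isLeast hne
  obtain ⟨b, hb, hb'⟩ := hK'.exists_isGreatest hne
  have h1 := hsub ha
  have h2 := hsub hb
  have h3 : a ≤ 1 / 2 := ha' (mem_insert _ _)
  have h4 : 1 / 2 ≤ b := hb' (mem_insert _ _)
  refine ⟨a / 2, (1 + b) / 2, by linarith [h1.1], by linarith [h1.1], by linarith [h2.2],
    by linarith [h2.2], fun x hx => ⟨?_, ?_⟩⟩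
  · linarith [ha' (mem_insert_of_mem _ hx), h1.1]
  · linarith [hb' (mem_insert_of_mem _ hx), h2.2]

theorem setIntegral_Ioo_eq_intervalIntegral {a b : ℝ} (ha : 0 < a) (hab : a ≤ b) (hb : b < 1)
    {F : ℝ → ℝ} (hF : ∀ x, x ∉ Icc a b → F x = 0) :
    ∫ x in Ioo 0 1, F x = ∫ x in a..b, F x := by
  rw [intervalIntegral.integral_of_le hab, ← integral_Icc_eq_integral_Ioc]
  exact setIntegral_eq_of_subset_of_forall_sdiff_eq_zero measurableSet_Ioo
    (fun x hx => ⟨ha.trans_le hx.1, hx.2.trans_lt hb⟩) fun x hx => hF x hx.2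

theorem eq_zero_of_notMem_Icc {ψ : ℝ → ℝ} {a b : ℝ} (h : tsupport ψ ⊆ Icc a b) {x : ℝ}
    (hx : x ∉ Icc a b) : ψ x = 0 :=
  image_eq_zero_of_notMem_tsupport fun hx' => hx (h hx')

theorem deriv_eq_zero_of_notMem_Icc {ψ : ℝ → ℝ} {a b : ℝ} (h : tsupport ψ ⊆ Icc a b) {x : ℝ}
    (hx : x ∉ Icc a b) : deriv ψ x = 0 :=
  eq_zero_of_notMem_Icc ((tsupport_deriv_subset (𝕜 := ℝ)).trans h) hx

theorem intervalIntegrable_of_locallyIntegrableOn {H : ℝ → ℝ}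
    (hH : LocallyIntegrableOn H (Ioo 0 1)) {a b : ℝ} (ha : a ∈ Ioo (0 : ℝ) 1)
    (hb : b ∈ Ioo (0 : ℝ) 1) : IntervalIntegrable H volume a b := by
  refine IntegrableOn.intervalIntegrable ?_
  exact hH.integrableOn_compact_subset (OrdConnected.uIcc_subset ordConnected_Ioo ha hb)
    isCompact_uIcc

theorem continuousOn_primitive_Ioo {H : ℝ → ℝ} (hH : LocallyIntegrableOn H (Ioo 0 1)) :
    ContinuousOn (fun x => ∫ t in (1 / 2 : ℝ)..x, H t) (Ioo 0 1) := by
  intro x hx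
  have hm : min (x / 2) (1 / 4) ∈ Ioo (0 : ℝ) 1 :=
    ⟨lt_min (by linarith [hx.1]) (by norm_num), (min_le_right _ _).trans_lt (by norm_num)⟩
  have hM : max ((1 + x) / 2) (3 / 4) ∈ Ioo (0 : ℝ) 1 :=
    ⟨lt_max_of_lt_right (by norm_num), max_lt (by linarith [hx.2]) (by norm_num)⟩
  have h1 := (intervalIntegrable_of_locallyIntegrableOn hH hm hM)
  have h2 : min (x / 2) (1 / 4) < x := (min_le_left _ _).trans_lt (by linarith [hx.1])
  have h3 : x < max ((1 + x) / 2) (3 / 4) := lt_of_lt_of_le (by linarith [hx.2]) (le_max_left _ _)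
  have h4 := intervalIntegral.continuousOn_primitive_interval' (a := 1 / 2) h1 (by
    rw [uIcc_of_le (h2.trans h3).le]
    exact ⟨(min_le_right _ _).trans (by norm_num), le_trans (by norm_num) (le_max_right _ _)⟩)
  rw [uIcc_of_le (h2.trans h3).le] at h4
  exact (h4.continuousAt (Icc_mem_nhds h2 h3)).continuousWithinAt

theorem integral_primitive_mul_deriv {H : ℝ → ℝ} (hH : LocallyIntegrableOn H (Ioo 0 1))
    {ψ : ℝ → ℝ} (hψ : ContDiff ℝ 1 ψ) (hc : HasCompactSupport ψ) (hs : tsupport ψ ⊆ Ioo 0 1) :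
    ∫ x in Ioo 0 1, (∫ t in (1 / 2 : ℝ)..x, H t) * deriv ψ x = - ∫ x in Ioo 0 1, H x * ψ x := by
  obtain ⟨a, b, ha, ha', hb', hb, hab⟩ := exists_Icc_of_isCompact hc hs
  have hlt : a / 2 < (1 + b) / 2 := by linarith
  have hsub : Icc a b ⊆ Icc (a / 2) ((1 + b) / 2) := Icc_subset_Icc (by linarith) (by linarith)
  have hab2 := hab.trans hsub
  rw [setIntegral_Ioo_eq_intervalIntegral (a := a / 2) (b := (1 + b) / 2) (by linarith) hlt.le
      (by linarith) (fun x hx => by rw [deriv_eq_zero_of_notMem_Icc hab2 hx, mul_zero]),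
    setIntegral_Ioo_eq_intervalIntegral (a := a / 2) (b := (1 + b) / 2) (by linarith) hlt.le
      (by linarith) (fun x hx => by rw [eq_zero_of_notMem_Icc hab2 hx, mul_zero])]
  have hi : IntervalIntegrable H volume (a / 2) ((1 + b) / 2) :=
    intervalIntegrable_of_locallyIntegrableOn hH ⟨by linarith, by linarith⟩
      ⟨by linarith, by linarith⟩
  have hmem : (1 / 2 : ℝ) ∈ uIcc (a / 2) ((1 + b) / 2) := by
    rw [uIcc_of_le hlt.le]
    constructor <;> linarith
  rw [(hi.absolutelyContinuousOnInterval_intervalIntegral hmem).integral_mul_deriv_eq_deriv_mul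
    hψ.contDiffOn.absolutelyContinuousOnInterval,
    eq_zero_of_notMem_Icc hab (x := a / 2) (fun h => by linarith [h.1]),
    eq_zero_of_notMem_Icc hab (x := (1 + b) / 2) (fun h => by linarith [h.2])]
  simp only [mul_zero, sub_zero, zero_sub]
  congr 1
  refine intervalIntegral.integral_congr_ae ?_
  filter_upwards [hi.ae_hasDerivAt_integral] with x hx hxm
  rw [(hx (uIoc_subset_uIcc hxm) _ hmem).deriv]

theorem integrableOn_mul_of_tsupport_subset {Z φ : ℝ → ℝ} (hZ : LocallyIntegrableOn Z (Ioo 0 1))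
    (hφ : Continuous φ) (hc : HasCompactSupport φ) (hs : tsupport φ ⊆ Ioo 0 1) :
    IntegrableOn (fun x => Z x * φ x) (Ioo 0 1) := by
  have h1 : IntegrableOn (fun x => Z x * φ x) (tsupport φ) :=
    (hZ.integrableOn_compact_subset hs hc).mul_continuousOn hφ.continuousOn hc
  refine ((integrableOn_iff_integrable_of_support_subset ?_).1 h1).integrableOn
  intro x hx
  refine subset_tsupport φ fun h0 => hx ?_
  simp only [h0, mul_zero]

/-- The du Bois-Reymond lemma: a test function of mean zero is the derivative of a test function, so
`U` is orthogonal to all of them; the constant is the mean of `U` against a fixed bump `θ`. -/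
theorem ae_eq_const_of_integral_mul_deriv_eq_zero {U : ℝ → ℝ}
    (hU : LocallyIntegrableOn U (Ioo 0 1))
    (h : ∀ ψ : ℝ → ℝ, ContDiff ℝ ∞ ψ → HasCompactSupport ψ → tsupport ψ ⊆ Ioo 0 1 →
      ∫ x in Ioo 0 1, U x * deriv ψ x = 0) :
    ∃ c, ∀ᵐ x ∂(volume.restrict (Ioo 0 1)), U x = c := by
  let θb : ContDiffBump (1 / 2 : ℝ) := ⟨1 / 8, 1 / 4, by norm_num, by norm_num⟩
  set θ : ℝ → ℝ := θb.normed volume with hθ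
  have hθd : ContDiff ℝ ∞ θ := θb.contDiff_normed
  have hθi : ∫ x, θ x = 1 := θb.integral_normed
  have hθs : tsupport θ ⊆ Ioo 0 1 := by
    rw [hθ, θb.tsupport_normed_eq]
    intro x hx
    rw [Real.closedBall_eq_Icc] at hx
    constructor <;> linarith [hx.1, hx.2, show θb.rOut = 1 / 4 from rfl]
  have hθc : HasCompactSupport θ := θb.hasCompactSupport_normed
  have hint := fun φ : ℝ → ℝ => integrableOn_mul_of_tsupport_subset (φ := φ) hU
  refine ⟨∫ x in Ioo 0 1, U x * θ x, ?_⟩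
  set c := ∫ x in Ioo 0 1, U x * θ x
  have key : ∀ᵐ x, x ∈ Ioo (0 : ℝ) 1 → U x - c = 0 := by
    refine isOpen_Ioo.ae_eq_zero_of_integral_contDiff_smul_eq_zero
      (hU.sub (locallyIntegrableOn_const c)) fun φ hφ hc hs => ?_
    set m := ∫ x, φ x
    -- Subtracting `m θ` makes the mean zero, so that the primitive `ψ` of `D` has compact support.
    set D : ℝ → ℝ := fun x => φ x - m * θ x
    have hDd : ContDiff ℝ ∞ D := hφ.sub (contDiff_const.mul hθd)
    set ψ : ℝ → ℝ := fun x => ∫ t in (0 : ℝ)..x, D t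
    have hψD : ∀ x, HasDerivAt ψ (D x) x := fun x =>
      hDd.continuous.integral_hasStrictDerivAt 0 x |>.hasDerivAt
    have hψd : ContDiff ℝ ∞ ψ := by
      rw [contDiff_infty_iff_deriv]
      refine ⟨fun x => (hψD x).differentiableAt, ?_⟩
      rwa [show deriv ψ = D from funext fun x => (hψD x).deriv]
    obtain ⟨a, b, ha, ha', hb', hb, hab⟩ := exists_Icc_of_isCompact
      (HasCompactSupport.isCompact hc |>.union hθc.isCompact) (union_subset hs hθs)
    have hD0 : ∀ x, x ∉ Icc a b → D x = 0 := fun x hx => by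
      simp only [D]
      rw [eq_zero_of_notMem_Icc (subset_union_left.trans hab) hx,
        eq_zero_of_notMem_Icc (subset_union_right.trans hab) hx]
      simp
    have hDint : ∫ x, D x = 0 := by
      simp only [D]
      rw [integral_sub (hφ.continuous.integrable_of_hasCompactSupport hc)
        ((hθd.continuous.integrable_of_hasCompactSupport hθc).const_mul m),
        integral_const_mul, hθi]
      simp [m]
    -- To the left of `a` nothing has been integrated yet; to the right of `b` the primitive equals
    -- the total integral of `D`, which is zero.
    have hψ0 : ∀ x, x ∉ Icc a b → ψ x = 0 := by
      intro x hx
      by_cases hxa : x < a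
      · refine intervalIntegral.integral_zero_ae (Filter.Eventually.of_forall fun t ht => ?_)
        refine hD0 t fun h => ?_
        rcases uIoc_subset_uIcc ht with ⟨_, h2⟩
        have : max 0 x < a := max_lt ha hxa
        exact absurd h.1 (not_le.2 (h2.trans_lt this))
      · have hxb : b < x := by
          by_contra hcon
          exact hx ⟨not_lt.1 hxa, not_lt.1 hcon⟩
        simp only [ψ]
        rw [intervalIntegral.integral_of_le (by linarith)]
        refine Eq.trans ?_ hDint
        refine setIntegral_eq_integral_of_forall_compl_eq_zero fun t ht => hD0 t fun h => ht ?_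
        exact ⟨ha.trans_le h.1, h.2.trans hxb.le⟩
    have hts : tsupport ψ ⊆ Icc a b :=
      closure_minimal (fun x hx => by_contra fun h => hx (hψ0 x h)) isClosed_Icc
    have h1 := h ψ hψd (HasCompactSupport.of_support_subset_isCompact isCompact_Icc
      ((subset_tsupport _).trans hts))
      (hts.trans fun x hx => ⟨ha.trans_le hx.1, hx.2.trans_lt hb⟩)
    simp only [fun x => (hψD x).deriv, D] at h1
    have h2 : ∫ x in Ioo 0 1, (U x * φ x - m * (U x * θ x)) = 0 := by
      refine Eq.trans (integral_congr_ae (Filter.Eventually.of_forall fun x => ?_)) h1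
      ring
    rw [integral_sub (hint φ hφ.continuous hc hs) ((hint θ hθd.continuous hθc hθs).const_mul m),
      integral_const_mul] at h2
    rw [← setIntegral_eq_integral_of_forall_compl_eq_zero (s := Ioo (0 : ℝ) 1)
      (fun x hx => by rw [image_eq_zero_of_notMem_tsupport fun hx' => hx (hs hx'), zero_smul])]
    have h3 : ∀ x, φ x • (U x - c) = U x * φ x - c * φ x := fun x => by
      simp only [smul_eq_mul]
      ring
    have h4 : ∫ x in Ioo (0 : ℝ) 1, φ x = m :=
      setIntegral_eq_integral_of_forall_compl_eq_zero
        fun x hx => image_eq_zero_of_notMem_tsupport fun hx' => hx (hs hx')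
    simp only [h3]
    rw [integral_sub (hint φ hφ.continuous hc hs)
      ((hφ.continuous.integrable_of_hasCompactSupport hc).integrableOn.const_mul c),
      integral_const_mul, h4]
    linarith
  rw [ae_restrict_iff' measurableSet_Ioo]
  filter_upwards [key] with x hx hxm
  linarith [hx hxm]

/-- A function with weak derivative `H` on `(0, 1)` is a primitive of `H`. -/
theorem ae_eq_const_add_primitive {V H : ℝ → ℝ} (hV : LocallyIntegrableOn V (Ioo 0 1))
    (hH : LocallyIntegrableOn H (Ioo 0 1))
    (h : ∀ ψ : ℝ → ℝ, ContDiff ℝ ∞ ψ → HasCompactSupport ψ → tsupport ψ ⊆ Ioo 0 1 →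
      ∫ x in Ioo 0 1, V x * deriv ψ x = - ∫ x in Ioo 0 1, H x * ψ x) :
    ∃ c, ∀ᵐ x ∂(volume.restrict (Ioo 0 1)), V x = c + ∫ t in (1 / 2 : ℝ)..x, H t := by
  have hW : LocallyIntegrableOn (fun x => ∫ t in (1 / 2 : ℝ)..x, H t) (Ioo 0 1) :=
    (continuousOn_primitive_Ioo hH).locallyIntegrableOn measurableSet_Ioo
  obtain ⟨c, hc⟩ := ae_eq_const_of_integral_mul_deriv_eq_zero (hV.sub hW)
    (fun ψ hψ hcs hs => by
      have h1 := h ψ hψ hcs hs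
      have h2 := integral_primitive_mul_deriv hH (hψ.of_le (by exact_mod_cast le_top)) hcs hs
      have hdc : Continuous (deriv ψ) := hψ.continuous_deriv (by simp)
      have hds : tsupport (deriv ψ) ⊆ Ioo 0 1 := (tsupport_deriv_subset (𝕜 := ℝ)).trans hs
      have h3 : ∀ x, (V - fun x => ∫ t in (1 / 2 : ℝ)..x, H t) x * deriv ψ x
          = V x * deriv ψ x - (∫ t in (1 / 2 : ℝ)..x, H t) * deriv ψ x := fun x => by
        simp only [Pi.sub_apply]
        ring
      simp only [h3]
      rw [integral_sub (integrableOn_mul_of_tsupport_subset hV hdc hcs.deriv hds)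
        (integrableOn_mul_of_tsupport_subset hW hdc hcs.deriv hds), h1, h2]
      ring)
  refine ⟨c, ?_⟩
  filter_upwards [hc] with x hx
  simp only [Pi.sub_apply] at hx
  linarith


/-! ### Radial test functions on `ℝ^N` built from functions on `(0, 1)`. -/

section RadialLift

variable {E : Type*} [NormedAddCommGroup E] {ψ : ℝ → ℝ}

theorem eventually_eq_zero_of_notMem_Ioo (hs : tsupport ψ ⊆ Ioo 0 1) {r : ℝ}
    (hr : r ∉ Ioo (0 : ℝ) 1) : ψ =ᶠ[nhds r] 0 :=
  notMem_tsupport_iff_eventuallyEq.1 fun h => hr (hs h)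

theorem eventually_comp_norm_eq_zero (hs : tsupport ψ ⊆ Ioo 0 1) :
    (fun x : E => ψ ‖x‖) =ᶠ[nhds 0] 0 := by
  have h1 := eventually_eq_zero_of_notMem_Ioo hs (r := 0) (by simp)
  have h2 : Filter.Tendsto (fun x : E => ‖x‖) (nhds 0) (nhds 0) := by
    simpa using (continuous_norm (E := E)).tendsto 0
  exact h2.eventually h1

theorem tsupport_comp_norm_subset :
    tsupport (fun x : E => ψ ‖x‖) ⊆ {x | ‖x‖ ∈ tsupport ψ} := by
  refine closure_minimal (fun x hx => subset_tsupport ψ hx) ?_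
  exact (isClosed_tsupport ψ).preimage continuous_norm

variable [InnerProductSpace ℝ E]

/-- The norm is singular only at the origin, near which the composition vanishes. -/
theorem contDiff_comp_norm {n : ℕ∞} (hψ : ContDiff ℝ n ψ) (hs : tsupport ψ ⊆ Ioo 0 1) :
    ContDiff ℝ n (fun x : E => ψ ‖x‖) := by
  refine contDiff_iff_contDiffAt.2 fun x => ?_
  by_cases hx : x = 0
  · rw [hx]
    exact (contDiffAt_const (c := (0 : ℝ))).congr_of_eventuallyEq (eventually_comp_norm_eq_zero hs)
  · exact hψ.contDiffAt.comp x (contDiffAt_norm ℝ hx)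

theorem hasCompactSupport_comp_norm [FiniteDimensional ℝ E] (hs : tsupport ψ ⊆ Ioo 0 1) :
    HasCompactSupport (fun x : E => ψ ‖x‖) := by
  have := FiniteDimensional.proper_real E
  refine HasCompactSupport.of_support_subset_isCompact (isCompact_closedBall (0 : E) 1) ?_
  intro x hx
  have := hs (subset_tsupport ψ hx)
  simpa using this.2.le

theorem hasFDerivAt_comp_norm {ψ' : ℝ} {x : E} (hx : x ≠ 0) (hψ : HasDerivAt ψ ψ' ‖x‖) :
    HasFDerivAt (fun x : E => ψ ‖x‖) ((ψ' / ‖x‖) • innerSL ℝ x) x := by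
  have hx' : ‖x‖ ≠ 0 := norm_ne_zero_iff.2 hx
  have h1 := (hasStrictFDerivAt_norm_sq x).hasFDerivAt.sqrt (by positivity)
  have h2 : HasFDerivAt (fun x : E => ‖x‖) ((1 / ‖x‖) • innerSL ℝ x) x := by
    have e : (fun x : E => ‖x‖) = fun x => √(‖x‖ ^ 2) := by
      funext y
      rw [Real.sqrt_sq (norm_nonneg y)]
    rw [e]
    convert! h1 using 1
    ext y
    simp only [Real.sqrt_sq (norm_nonneg x), smul_apply, smul_eq_mul,
      innerSL_apply_apply]
    simp
    field_simp
  have h3 := hψ.comp_hasFDerivAt x h2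
  convert! h3 using 1
  rw [smul_smul]
  congr 1
  ring

theorem fderiv_comp_norm (hψ : Differentiable ℝ ψ) (hs : tsupport ψ ⊆ Ioo 0 1) (x v : E) :
    fderiv ℝ (fun x : E => ψ ‖x‖) x v = deriv ψ ‖x‖ / ‖x‖ * inner ℝ x v := by
  by_cases hx : x = 0
  · rw [hx, (eventually_comp_norm_eq_zero hs).fderiv_eq]
    simp
  · rw [(hasFDerivAt_comp_norm hx (hψ _).hasDerivAt).fderiv]
    simp

theorem gradient_comp_norm [CompleteSpace E] (hψ : Differentiable ℝ ψ)
    (hs : tsupport ψ ⊆ Ioo 0 1) (x : E) :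
    ∇ (fun x : E => ψ ‖x‖) x = (deriv ψ ‖x‖ / ‖x‖) • x := by
  refine ext_inner_right ℝ fun v => ?_
  rw [inner_gradient_left, fderiv_comp_norm hψ hs, inner_smul_left]
  simp

theorem norm_gradient_comp_norm [CompleteSpace E] (hψ : Differentiable ℝ ψ)
    (hs : tsupport ψ ⊆ Ioo 0 1) (x : E) :
    ‖∇ (fun x : E => ψ ‖x‖) x‖ = |deriv ψ ‖x‖| := by
  rw [gradient_comp_norm hψ hs]
  by_cases hx : x = 0
  · rw [hx, norm_zero, (eventually_eq_zero_of_notMem_Ioo hs (r := 0) (by simp)).deriv_eq]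
    simp
  · have hx' : ‖x‖ ≠ 0 := norm_ne_zero_iff.2 hx
    rw [norm_smul, norm_div, norm_norm, div_mul_cancel₀ _ hx', Real.norm_eq_abs]

end RadialLift

theorem isTest_comp_norm {N : ℕ} {ψ : ℝ → ℝ} (hψ : ContDiff ℝ 1 ψ) (hs : tsupport ψ ⊆ Ioo 0 1) :
    IsTest (fun x : EuclideanSpace ℝ (Fin N) => ψ ‖x‖) where
  contDiff := contDiff_comp_norm (n := 1) hψ hs
  hasCompactSupport := hasCompactSupport_comp_norm hs
  tsupport_subset := fun x hx => by
    have h := hs (tsupport_comp_norm_subset hx)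
    refine ⟨by simpa using h.2, ?_⟩
    have : ‖x‖ ≠ 0 := h.1.ne'
    simpa using this

/-! ### The punctured ball, the annulus, and weak gradients on them. -/

section Sets

variable {N : ℕ}

theorem unitBall_ae_eq [Nontrivial (EuclideanSpace ℝ (Fin N))] :
    (unitBall N : Set (EuclideanSpace ℝ (Fin N))) =ᵐ[volume] {x | ‖x‖ ∈ Ioo (0 : ℝ) 1} := by
  have h : ({x | ‖x‖ ∈ Ioo (0 : ℝ) 1} : Set (EuclideanSpace ℝ (Fin N))) = unitBall N \ {0} := by
    ext x
    simp [and_comm]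
  rw [h]
  exact (sdiff_null_ae_eq_self (measure_singleton _)).symm

theorem restrict_unitBall [Nontrivial (EuclideanSpace ℝ (Fin N))] :
    (volume : Measure (EuclideanSpace ℝ (Fin N))).restrict (unitBall N) =
      volume.restrict {x | ‖x‖ ∈ Ioo (0 : ℝ) 1} :=
  Measure.restrict_congr_set unitBall_ae_eq

theorem annulus_eq :
    (annulus N : Set (EuclideanSpace ℝ (Fin N))) = {x | ‖x‖ ∈ Ioo (1 / 2 : ℝ) 1} := by
  ext x
  simp [and_comm]

theorem annulus_subset : (annulus N : Set (EuclideanSpace ℝ (Fin N))) ⊆ unitBall N :=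
  sdiff_subset

theorem isOpen_annulus : IsOpen (annulus N : Set (EuclideanSpace ℝ (Fin N))) :=
  isOpen_ball.sdiff isClosed_closedBall

end Sets

section WeakGradient

variable {N : ℕ} {U A : Set (EuclideanSpace ℝ (Fin N))} {u : EuclideanSpace ℝ (Fin N) → ℝ}
  {g : EuclideanSpace ℝ (Fin N) → EuclideanSpace ℝ (Fin N)}

theorem HasWeakGradient.mono (hAU : A ⊆ U) (h : HasWeakGradient U u g) :
    HasWeakGradient A u g where
  locallyIntegrableOn := h.locallyIntegrableOn.mono_set hAU
  locallyIntegrableOn_grad := h.locallyIntegrableOn_grad.mono_set hAU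
  integral_eq := fun φ v hφ hc hs => by
    have h0 : ∀ x, x ∉ A → φ x = 0 := fun x hx =>
      image_eq_zero_of_notMem_tsupport fun h => hx (hs h)
    have h1 : ∀ x, x ∉ A → fderiv ℝ φ x = 0 := fun x hx =>
      image_eq_zero_of_notMem_tsupport fun h => hx (hs (tsupport_fderiv_subset ℝ h))
    have h2 := h.integral_eq φ v hφ hc (hs.trans hAU)
    rw [setIntegral_eq_integral_of_forall_compl_eq_zero
        (fun x hx => by rw [h1 x fun h => hx (hAU h)]; simp),
      setIntegral_eq_integral_of_forall_compl_eq_zero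
        (fun x hx => by rw [h0 x fun h => hx (hAU h)]; simp)] at h2
    rw [setIntegral_eq_integral_of_forall_compl_eq_zero (fun x hx => by rw [h1 x hx]; simp),
      setIntegral_eq_integral_of_forall_compl_eq_zero (fun x hx => by rw [h0 x hx]; simp), h2]

theorem HasWeakGradient.weakGradient (h : HasWeakGradient U u g) :
    HasWeakGradient U u (weakGradient U u) :=
  Classical.epsilon_spec (p := HasWeakGradient U u) ⟨g, h⟩

theorem MemH1.hasWeakGradient (h : MemH1 U u) : HasWeakGradient U u (HardyHenon.weakGradient U u) :=
  let ⟨_, hg, _⟩ := h.2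
  hg.weakGradient

theorem MemH1.memLp_weakGradient (hU : IsOpen U) (h : MemH1 U u) :
    MemLp (HardyHenon.weakGradient U u) 2 (volume.restrict U) := by
  obtain ⟨g, hg, hg2⟩ := h.2
  exact hg2.ae_eq (hg.ae_eq hU hg.weakGradient)

/-- The norm on the annulus uses the gradient chosen there, the equation the one chosen on the ball;
uniqueness identifies them. -/
theorem MemH1.weakGradient_ae_eq (hA : IsOpen A) (hAU : A ⊆ U) (h : MemH1 U u) :
    ∀ᵐ x ∂(volume.restrict A), HardyHenon.weakGradient A u x = HardyHenon.weakGradient U u x := by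
  have h1 := h.hasWeakGradient.mono hAU
  exact h1.weakGradient.ae_eq hA h1

end WeakGradient


/-! ### Reduction of the weak formulations to one variable. -/

section RadialComponent

variable {E : Type*} [NormedAddCommGroup E] [InnerProductSpace ℝ E]

/-- The component of the vector field `g` in the direction `x / |x|`. -/
noncomputable def radialComponent (g : E → E) (x : E) : ℝ := inner ℝ (g x) (‖x‖⁻¹ • x)

theorem norm_radialComponent_le (g : E → E) (x : E) : ‖radialComponent g x‖ ≤ ‖g x‖ := by
  refine (norm_inner_le_norm _ _).trans (mul_le_of_le_one_right (norm_nonneg _) ?_)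
  rw [norm_smul, norm_inv, norm_norm]
  exact inv_mul_le_one

theorem memLp_radialComponent [MeasurableSpace E] [BorelSpace E] [FiniteDimensional ℝ E]
    {g : E → E} {μ : Measure E} {p : ℝ≥0∞} (hg : MemLp g p μ) : MemLp (radialComponent g) p μ := by
  refine hg.of_le ?_ (Filter.Eventually.of_forall fun x => norm_radialComponent_le g x)
  have h1 : AEStronglyMeasurable (fun x : E => ‖x‖⁻¹ • x) μ :=
    (Measurable.smul (by fun_prop) measurable_id).aestronglyMeasurable
  exact hg.aestronglyMeasurable.inner h1

theorem inner_eq_radialComponent_mul_norm (g : E → E) (x : E) :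
    inner ℝ (g x) x = radialComponent g x * ‖x‖ := by
  by_cases hx : x = 0
  · simp [hx]
  · have hx' : ‖x‖ ≠ 0 := norm_ne_zero_iff.2 hx
    rw [radialComponent, inner_smul_right]
    field_simp

end RadialComponent

section DivisionByPowers

theorem contDiff_mul_of_contDiffOn {n : ℕ∞} {ψ k : ℝ → ℝ} (hψ : ContDiff ℝ n ψ)
    (hs : tsupport ψ ⊆ Ioo 0 1) (hk : ContDiffOn ℝ n k (Ioo 0 1)) :
    ContDiff ℝ n (fun r => ψ r * k r) := by
  refine contDiff_iff_contDiffAt.2 fun r => ?_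
  by_cases hr : r ∈ Ioo (0 : ℝ) 1
  · exact hψ.contDiffAt.mul (hk.contDiffAt (isOpen_Ioo.mem_nhds hr))
  · refine (contDiffAt_const (c := (0 : ℝ))).congr_of_eventuallyEq ?_
    filter_upwards [eventually_eq_zero_of_notMem_Ioo hs hr] with t ht
    simp [ht]

theorem tsupport_mul_subset_Ioo {ψ k : ℝ → ℝ} (hs : tsupport ψ ⊆ Ioo 0 1) :
    tsupport (fun r => ψ r * k r) ⊆ Ioo 0 1 :=
  (tsupport_mul_subset_left (f := ψ) (g := k)).trans hs

end DivisionByPowers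

theorem IntegrableOn.mul_of_hasCompactSupport {X : Type*} [TopologicalSpace X] [MeasurableSpace X]
    [OpensMeasurableSpace X] [SecondCountableTopology X] {μ : Measure X} {s : Set X} {h k : X → ℝ}
    (hh : IntegrableOn h s μ) (hk : Continuous k) (hc : HasCompactSupport k) :
    IntegrableOn (fun x => h x * k x) s μ := by
  obtain ⟨C, hC⟩ := hc.exists_bound_of_continuous hk
  exact Integrable.mul_bdd (c := C) hh hk.aestronglyMeasurable (Filter.Eventually.of_forall hC)

section WeakDerivative

variable {N : ℕ} {u : EuclideanSpace ℝ (Fin N) → ℝ}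
  {g : EuclideanSpace ℝ (Fin N) → EuclideanSpace ℝ (Fin N)}

/-- The weak divergence identity for the radial vector field `ψ(|x|) x`. -/
theorem HasWeakGradient.integral_radial_field {U : Set (EuclideanSpace ℝ (Fin N))}
    (h : HasWeakGradient U u g) (hU : {x | ‖x‖ ∈ Ioo (0 : ℝ) 1} ⊆ U)
    (hu : IntegrableOn u U) (hg : IntegrableOn g U)
    {ψ : ℝ → ℝ} (hψ : ContDiff ℝ ∞ ψ) (hs : tsupport ψ ⊆ Ioo 0 1) :
    ∫ x in U, u x * (N * ψ ‖x‖ + deriv ψ ‖x‖ * ‖x‖) =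
      - ∫ x in U, inner ℝ (g x) x * ψ ‖x‖ := by
  let e : Fin N → EuclideanSpace ℝ (Fin N) := fun i => EuclideanSpace.single i 1
  let Ψ : EuclideanSpace ℝ (Fin N) → ℝ := fun x => ψ ‖x‖
  -- The `i`-th coordinate of the field `ψ(|x|) x`, tested in the direction `e i`; summing over `i`
  -- produces the divergence `N ψ + |x| ψ'`.
  let φ : Fin N → EuclideanSpace ℝ (Fin N) → ℝ := fun i x => x i * Ψ x
  have hΨ : ContDiff ℝ ∞ Ψ := contDiff_comp_norm hψ hs
  have hΨc : HasCompactSupport Ψ := hasCompactSupport_comp_norm hs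
  have hcoord : ∀ i, ContDiff ℝ ∞ (fun x : EuclideanSpace ℝ (Fin N) => x i) := fun i =>
    (EuclideanSpace.proj i : EuclideanSpace ℝ (Fin N) →L[ℝ] ℝ).contDiff
  have hφ : ∀ i, ContDiff ℝ ∞ (φ i) := fun i => (hcoord i).mul hΨ
  have hφc : ∀ i, HasCompactSupport (φ i) := fun i => hΨc.mul_left
  have hφs : ∀ i, tsupport (φ i) ⊆ U := fun i =>
    ((tsupport_mul_subset_right (f := fun x : EuclideanSpace ℝ (Fin N) => x i) (g := Ψ)).trans
      tsupport_comp_norm_subset).trans fun x hx => hU (hs hx)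
  have hψd : Differentiable ℝ ψ := hψ.differentiable (by simp)
  have hderiv : ∀ i x, fderiv ℝ (φ i) x (e i) = Ψ x + x i * (deriv ψ ‖x‖ / ‖x‖ * x i) := by
    intro i x
    have h1 : HasFDerivAt (fun x : EuclideanSpace ℝ (Fin N) => x i)
        (EuclideanSpace.proj i : EuclideanSpace ℝ (Fin N) →L[ℝ] ℝ) x :=
      (EuclideanSpace.proj i : EuclideanSpace ℝ (Fin N) →L[ℝ] ℝ).hasFDerivAt
    have h2 : HasFDerivAt Ψ (fderiv ℝ Ψ x) x :=
      (hΨ.differentiable (by simp) x).hasFDerivAt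
    rw [show φ i = (fun x : EuclideanSpace ℝ (Fin N) => x i) * Ψ from rfl, (h1.mul h2).fderiv]
    simp only [add_apply, smul_apply, smul_eq_mul]
    rw [fderiv_comp_norm hψd hs]
    simp [e, EuclideanSpace.inner_single_right]
    ring
  have hsum : ∀ i, ∫ x in U, u x * fderiv ℝ (φ i) x (e i)
      = - ∫ x in U, inner ℝ (g x) (e i) * φ i x := fun i =>
    h.integral_eq (φ i) (e i) (hφ i) (hφc i) (hφs i)
  have hi1 : ∀ i, IntegrableOn (fun x => u x * fderiv ℝ (φ i) x (e i)) U := fun i => by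
    refine IntegrableOn.mul_of_hasCompactSupport hu ?_ ?_
    · exact ((hφ i).continuous_fderiv (by simp)).clm_apply continuous_const
    · exact ((hφc i).fderiv ℝ).comp_left (g := fun L => L (e i)) (by simp)
  have hi2 : ∀ i, IntegrableOn (fun x => inner ℝ (g x) (e i) * φ i x) U := fun i => by
    exact IntegrableOn.mul_of_hasCompactSupport (hg.inner_const (e i)) (hφ i).continuous (hφc i)
  have h3 := Finset.sum_congr (rfl : (Finset.univ : Finset (Fin N)) = Finset.univ)
    (fun i _ => hsum i)
  rw [Finset.sum_neg_distrib, ← integral_finsetSum _ (fun i _ => hi1 i),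
    ← integral_finsetSum _ (fun i _ => hi2 i)] at h3
  have hnorm : ∀ x : EuclideanSpace ℝ (Fin N), ∑ i, x i * x i = ‖x‖ ^ 2 := fun x => by
    rw [EuclideanSpace.norm_sq_eq]
    simp [sq]
  refine Eq.trans ?_ (h3.trans ?_)
  · refine integral_congr_ae (Filter.Eventually.of_forall fun x => ?_)
    simp only [hderiv, ← Finset.mul_sum]
    congr 1
    rw [Finset.sum_add_distrib, Finset.sum_const, Finset.card_univ, Fintype.card_fin,
      nsmul_eq_mul]
    congr 1
    have : ∑ i, x i * (deriv ψ ‖x‖ / ‖x‖ * x i) = deriv ψ ‖x‖ / ‖x‖ * ∑ i, x i * x i := by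
      rw [Finset.mul_sum]
      exact Finset.sum_congr rfl fun i _ => by ring
    rw [this, hnorm]
    by_cases hx : ‖x‖ = 0
    · simp [hx]
    · field_simp
  · refine congrArg Neg.neg (integral_congr_ae (Filter.Eventually.of_forall fun x => ?_))
    simp only [φ, Ψ, e]
    have : ∀ i, inner ℝ (g x) (EuclideanSpace.single i (1 : ℝ)) = g x i := fun i => by
      simp [EuclideanSpace.inner_single_right]
    simp only [this]
    rw [PiLp.inner_apply, Finset.sum_mul]
    refine Finset.sum_congr rfl fun i _ => ?_
    simp
    ring

end WeakDerivative

section WeakForms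

variable {N : ℕ} {u : EuclideanSpace ℝ (Fin N) → ℝ}
  {g : EuclideanSpace ℝ (Fin N) → EuclideanSpace ℝ (Fin N)}

theorem Ioo_zero_one_subset_Ioi : Ioo (0 : ℝ) 1 ⊆ Ioi 0 := fun _ h => h.1

theorem IntegrableOn.mul_comp_norm {h : EuclideanSpace ℝ (Fin N) → ℝ}
    {U : Set (EuclideanSpace ℝ (Fin N))} (hh : IntegrableOn h U) {F : ℝ → ℝ} (hF : Continuous F)
    (hs : tsupport F ⊆ Ioo 0 1) : IntegrableOn (fun x => h x * F ‖x‖) U := by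
  refine IntegrableOn.mul_of_hasCompactSupport hh ?_ (hasCompactSupport_comp_norm hs)
  exact (contDiff_comp_norm (n := 0) (contDiff_zero.2 hF) hs).continuous

variable [Nontrivial (EuclideanSpace ℝ (Fin N))]

theorem locallyIntegrableOn_sphericalMean {h : EuclideanSpace ℝ (Fin N) → ℝ}
    (hh : IntegrableOn h {x | ‖x‖ ∈ Ioo (0 : ℝ) 1}) :
    LocallyIntegrableOn (sphericalMean volume h) (Ioo 0 1) := by
  have h1 := (integrableOn_sphericalMean volume measurableSet_Ioo Ioo_zero_one_subset_Ioi
    hh).locallyIntegrableOn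
  rw [finrank_euclideanSpace_fin] at h1
  have h2 := h1.continuousOn_mul (g := fun r : ℝ => (r ^ (N - 1))⁻¹)
    ((continuousOn_pow _).inv₀ fun r hr => pow_ne_zero _ hr.1.ne') isOpen_Ioo.isLocallyClosed
  intro x hx
  obtain ⟨t, ht, ht'⟩ := h2 x hx
  refine ⟨t ∩ Ioo 0 1, Filter.inter_mem ht self_mem_nhdsWithin, ?_⟩
  have hae : ∀ᵐ r ∂(volume.restrict (t ∩ Ioo (0 : ℝ) 1)), r ∈ Ioo (0 : ℝ) 1 :=
    (ae_restrict_mem measurableSet_Ioo).filter_mono (ae_mono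
      (Measure.restrict_mono inter_subset_right le_rfl))
  refine (ht'.mono_set inter_subset_left).congr ?_
  filter_upwards [hae] with r hr
  rw [inv_mul_cancel_left₀ (pow_ne_zero _ hr.1.ne')]

/-- The spherical mean of the radial component of the gradient is the weak derivative of the
spherical mean of `u`. -/
theorem HasWeakGradient.integral_sphericalMean_mul_deriv (h : HasWeakGradient (unitBall N) u g)
    (hN : 0 < N) (hu : IntegrableOn u (unitBall N)) (hg : IntegrableOn g (unitBall N)) {ψ : ℝ → ℝ}
    (hψ : ContDiff ℝ ∞ ψ) (hs : tsupport ψ ⊆ Ioo 0 1) :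
    ∫ r in Ioo 0 1, sphericalMean volume u r * deriv ψ r =
      - ∫ r in Ioo 0 1, sphericalMean volume (radialComponent g) r * ψ r := by
  -- With `χ = ψ / r ^ N` the divergence `N χ + r χ'` is `r ^ (1 - N) ψ'`, which cancels the
  -- Jacobian `r ^ (N - 1)`.
  set k : ℝ → ℝ := fun r => (r ^ N)⁻¹ with hk
  have hkd : ContDiffOn ℝ ∞ k (Ioo 0 1) :=
    (contDiff_id.pow N).contDiffOn.inv fun r hr => pow_ne_zero _ hr.1.ne'
  set χ : ℝ → ℝ := fun r => ψ r * k r with hχ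
  have hχd : ContDiff ℝ ∞ χ := contDiff_mul_of_contDiffOn hψ hs hkd
  have hχs : tsupport χ ⊆ Ioo 0 1 := tsupport_mul_subset_Ioo hs
  have hsub : {x : EuclideanSpace ℝ (Fin N) | ‖x‖ ∈ Ioo (0 : ℝ) 1} ⊆ unitBall N := fun x hx => by
    simpa using hx.2
  have h1 := h.integral_radial_field hsub hu hg hχd hχs
  have hg' : IntegrableOn (radialComponent g) (unitBall N) :=
    memLp_one_iff_integrable.1 (memLp_radialComponent (memLp_one_iff_integrable.2 hg))
  have hFc : Continuous (fun r => N * χ r + deriv χ r * r) :=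
    (continuous_const.mul hχd.continuous).add ((hχd.continuous_deriv (by simp)).mul continuous_id)
  have hFs : tsupport (fun r => N * χ r + deriv χ r * r) ⊆ Ioo 0 1 := by
    refine (tsupport_add _ _).trans (union_subset ?_ ?_)
    · exact (tsupport_mul_subset_right (f := fun _ : ℝ => (N : ℝ)) (g := χ)).trans hχs
    · exact ((tsupport_mul_subset_left (f := deriv χ) (g := fun r => r)).trans
        (tsupport_deriv_subset (𝕜 := ℝ))).trans hχs
  have hGs : tsupport (fun r => r * χ r) ⊆ Ioo 0 1 :=
    (tsupport_mul_subset_right (f := fun r : ℝ => r) (g := χ)).trans hχs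
  have e1 := integral_mul_radial (μ := volume) (E := EuclideanSpace ℝ (Fin N)) measurableSet_Ioo
    Ioo_zero_one_subset_Ioi (h := u) (F := fun r => N * χ r + deriv χ r * r)
    (IntegrableOn.mul_comp_norm (hu.mono_set hsub) hFc hFs)
  have e2 := integral_mul_radial (μ := volume) (E := EuclideanSpace ℝ (Fin N)) measurableSet_Ioo
    Ioo_zero_one_subset_Ioi (h := radialComponent g) (F := fun r => r * χ r)
    (IntegrableOn.mul_comp_norm (hg'.mono_set hsub) (continuous_id.mul hχd.continuous) hGs)
  rw [finrank_euclideanSpace_fin] at e1 e2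
  have h2 : ∫ x in unitBall N, inner ℝ (g x) x * χ ‖x‖ =
      ∫ x in {x | ‖x‖ ∈ Ioo (0 : ℝ) 1}, radialComponent g x * (‖x‖ * χ ‖x‖) := by
    rw [restrict_unitBall]
    refine integral_congr_ae (Filter.Eventually.of_forall fun x => ?_)
    simp only [inner_eq_radialComponent_mul_norm]
    ring
  rw [h2, restrict_unitBall, e1, e2, ← mul_neg] at h1
  have h3 := mul_left_cancel₀ (sphereArea_pos (volume : Measure (EuclideanSpace ℝ (Fin N)))).ne' h1
  have hpow : ∀ r : ℝ, r ^ N = r ^ (N - 1) * r := fun r => by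
    rw [← pow_succ, Nat.sub_add_cancel hN]
  refine Eq.trans ?_ (h3.trans (congrArg Neg.neg ?_))
  · refine setIntegral_congr_fun measurableSet_Ioo fun r hr => ?_
    have hr0 : r ≠ 0 := hr.1.ne'
    have d1 : HasDerivAt k (-((N : ℝ) * r ^ (N - 1)) / (r ^ N) ^ 2) r :=
      (hasDerivAt_pow N r).fun_inv (pow_ne_zero _ hr0)
    have d2 : HasDerivAt χ _ r := ((hψ.differentiable (by simp) r).hasDerivAt).fun_mul d1
    simp only [d2.deriv]
    simp only [hχ, hk, hpow]
    field_simp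
    ring
  · refine setIntegral_congr_fun measurableSet_Ioo fun r hr => ?_
    have hr0 : r ≠ 0 := hr.1.ne'
    simp only [hχ, hk, hpow]
    field_simp

/-- A radial test function has a radial gradient, so only the radial component of the gradient of
`u` enters, and only through its spherical mean. -/
theorem IsWeakSolution.integral_sphericalMean_mul_deriv {α : ℝ} {f w : ℝ → ℝ}
    (h : IsWeakSolution α f u) (hg : IntegrableOn (weakGradient (unitBall N) u) (unitBall N))
    (hw : ∀ᵐ x ∂(volume.restrict (unitBall N)), u x = w ‖x‖) {ψ : ℝ → ℝ}
    (hψ : ContDiff ℝ 1 ψ) (hs : tsupport ψ ⊆ Ioo 0 1) :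
    ∫ r in Ioo 0 1, r ^ (N - 1) *
        sphericalMean volume (radialComponent (weakGradient (unitBall N) u)) r * deriv ψ r =
      ∫ r in Ioo 0 1, r ^ (N - 1) * (r ^ α * f (w r)) * ψ r := by
  set g := weakGradient (unitBall N) u
  have hsub : {x : EuclideanSpace ℝ (Fin N) | ‖x‖ ∈ Ioo (0 : ℝ) 1} ⊆ unitBall N := fun x hx => by
    simpa using hx.2
  have hg' : IntegrableOn (radialComponent g) (unitBall N) :=
    memLp_one_iff_integrable.1 (memLp_radialComponent (memLp_one_iff_integrable.2 hg))
  have h1 := h.2 _ (isTest_comp_norm hψ hs)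
  have e1 := integral_mul_radial (μ := volume) (E := EuclideanSpace ℝ (Fin N)) measurableSet_Ioo
    Ioo_zero_one_subset_Ioi (h := radialComponent g) (F := deriv ψ)
    (IntegrableOn.mul_comp_norm (hg'.mono_set hsub) (hψ.continuous_deriv le_rfl)
      ((tsupport_deriv_subset (𝕜 := ℝ)).trans hs))
  have e2 := integral_radial (μ := volume) (E := EuclideanSpace ℝ (Fin N)) measurableSet_Ioo
    Ioo_zero_one_subset_Ioi (fun r => r ^ α * f (w r) * ψ r)
  rw [finrank_euclideanSpace_fin] at e1 e2
  have h2 : ∫ x in unitBall N, inner ℝ (g x) (∇ (fun x => ψ ‖x‖) x) =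
      ∫ x in {x | ‖x‖ ∈ Ioo (0 : ℝ) 1}, radialComponent g x * deriv ψ ‖x‖ := by
    rw [restrict_unitBall]
    refine integral_congr_ae (Filter.Eventually.of_forall fun x => ?_)
    simp only
    rw [gradient_comp_norm (hψ.differentiable (by simp)) hs, inner_smul_right, radialComponent,
      inner_smul_right]
    ring
  have h3 : ∫ x in unitBall N, ‖x‖ ^ α * f (u x) * ψ ‖x‖ =
      ∫ x in {x : EuclideanSpace ℝ (Fin N) | ‖x‖ ∈ Ioo (0 : ℝ) 1},
        ‖x‖ ^ α * f (w ‖x‖) * ψ ‖x‖ := by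
    rw [← restrict_unitBall]
    refine integral_congr_ae ?_
    filter_upwards [hw] with x hx
    rw [hx]
  rw [h2, h3, e1, e2] at h1
  have h4 := mul_left_cancel₀ (sphereArea_pos (volume : Measure (EuclideanSpace ℝ (Fin N)))).ne' h1
  simpa only [mul_assoc] using h4

/-- Stability tested with radial functions. -/
theorem IsStable.integral_radial_nonneg {α : ℝ} {f w : ℝ → ℝ} (h : IsStable α f u)
    (hw : ∀ᵐ x ∂(volume.restrict (unitBall N)), u x = w ‖x‖) {ψ : ℝ → ℝ}
    (hψ : ContDiff ℝ 1 ψ) (hs : tsupport ψ ⊆ Ioo 0 1) :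
    0 ≤ ∫ r in Ioo 0 1, r ^ (N - 1) * (deriv ψ r ^ 2 - r ^ α * deriv f (w r) * ψ r ^ 2) := by
  have h1 := h.2 _ (isTest_comp_norm hψ hs)
  have e2 := integral_radial (μ := volume) (E := EuclideanSpace ℝ (Fin N)) measurableSet_Ioo
    Ioo_zero_one_subset_Ioi (fun r => deriv ψ r ^ 2 - r ^ α * deriv f (w r) * ψ r ^ 2)
  rw [finrank_euclideanSpace_fin] at e2
  have h3 : ∫ x in unitBall N, (‖∇ (fun x => ψ ‖x‖) x‖ ^ 2
        - ‖x‖ ^ α * deriv f (u x) * ψ ‖x‖ ^ 2) =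
      ∫ x in {x : EuclideanSpace ℝ (Fin N) | ‖x‖ ∈ Ioo (0 : ℝ) 1},
        (deriv ψ ‖x‖ ^ 2 - ‖x‖ ^ α * deriv f (w ‖x‖) * ψ ‖x‖ ^ 2) := by
    rw [← restrict_unitBall]
    refine integral_congr_ae ?_
    filter_upwards [hw] with x hx
    rw [hx, norm_gradient_comp_norm (hψ.differentiable (by simp)) hs, sq_abs]
  rw [h3, e2] at h1
  exact nonneg_of_mul_nonneg_right h1
    (sphereArea_pos (volume : Measure (EuclideanSpace ℝ (Fin N))))

end WeakForms

/-! ### The radial profile as a classical solution of an ordinary differential equation. -/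

theorem hasDerivAt_primitive_Ioo {p : ℝ → ℝ} (hp : ContinuousOn p (Ioo 0 1)) {r : ℝ}
    (hr : r ∈ Ioo (0 : ℝ) 1) : HasDerivAt (fun x => ∫ t in (1 / 2 : ℝ)..x, p t) (p r) r := by
  refine intervalIntegral.integral_hasDerivAt_right ?_ ?_ (hp.continuousAt (isOpen_Ioo.mem_nhds hr))
  · exact intervalIntegrable_of_locallyIntegrableOn
      (hp.locallyIntegrableOn measurableSet_Ioo) ⟨by norm_num, by norm_num⟩ hr
  · exact hp.stronglyMeasurableAtFilter isOpen_Ioo r hr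

/-- Integrability up to `1` is what extends the profile continuously to the boundary radius. -/
theorem continuousOn_primitive_Ioc {H : ℝ → ℝ} (hH : LocallyIntegrableOn H (Ioo 0 1))
    (hH' : IntegrableOn H (Ioo (1 / 2) 1)) :
    ContinuousOn (fun x => ∫ t in (1 / 2 : ℝ)..x, H t) (Ioc 0 1) := by
  have h1 : ContinuousOn (fun x => ∫ t in (1 / 2 : ℝ)..x, H t) (Icc (1 / 2) 1) := by
    have h2 : IntervalIntegrable H volume (1 / 2) 1 :=
      (intervalIntegrable_iff_integrableOn_Ioo_of_le (by norm_num)).2 hH'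
    have := intervalIntegral.continuousOn_primitive_interval' h2 left_mem_uIcc
    rwa [uIcc_of_le (by norm_num)] at this
  intro x hx
  by_cases hx1 : x < 1
  · exact ((continuousOn_primitive_Ioo hH).continuousAt
      (isOpen_Ioo.mem_nhds ⟨hx.1, hx1⟩)).continuousWithinAt
  · have hx1 : x = 1 := le_antisymm hx.2 (not_lt.1 hx1)
    subst hx1
    refine (h1 1 ⟨by norm_num, le_rfl⟩).mono_of_mem_nhdsWithin ?_
    have : Icc (1 / 2 : ℝ) 1 = Ici (1 / 2) ∩ Iic 1 := rfl
    rw [this]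
    refine Filter.inter_mem (mem_nhdsWithin_of_mem_nhds (Ici_mem_nhds (by norm_num))) ?_
    exact Filter.mem_of_superset self_mem_nhdsWithin fun y hy => hy.2

/-- `w` is a classical solution on `(0, 1)` of the radial equation
`-w'' - (N - 1) / r * w' = r ^ α f(w)`, with derivative `p`, continuous up to `r = 1`, and of finite
energy. -/
structure IsRadialSolution (N : ℕ) (α : ℝ) (f w p : ℝ → ℝ) : Prop where
  continuousOn : ContinuousOn w (Ioc 0 1)
  hasDerivAt : ∀ r ∈ Ioo (0 : ℝ) 1, HasDerivAt w (p r) r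
  hasDerivAt_deriv : ∀ r ∈ Ioo (0 : ℝ) 1,
    HasDerivAt p (-((N - 1) / r * p r) - r ^ α * f (w r)) r
  integrableOn : IntegrableOn (fun r => r ^ (N - 1) * p r ^ 2) (Ioo 0 1)

theorem IsRadialSolution.continuousOn_deriv {N : ℕ} {α : ℝ} {f w p : ℝ → ℝ}
    (h : IsRadialSolution N α f w p) : ContinuousOn p (Ioo 0 1) := fun r hr =>
  (h.hasDerivAt_deriv r hr).continuousAt.continuousWithinAt

theorem IsRadialSolution.continuousOn_Ioo {N : ℕ} {α : ℝ} {f w p : ℝ → ℝ}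
    (h : IsRadialSolution N α f w p) : ContinuousOn w (Ioo 0 1) :=
  h.continuousOn.mono Ioo_subset_Ioc_self

section Profile

variable {N : ℕ} [Nontrivial (EuclideanSpace ℝ (Fin N))] {u : EuclideanSpace ℝ (Fin N) → ℝ}
  {α : ℝ} {f : ℝ → ℝ}

/-- The spherical mean of `u` is a primitive of `G`, and it coincides almost everywhere with any
radial profile of `u`, however irregular that representative is. -/
theorem MemH1.exists_primitive (hN : 0 < N) (hu : MemH1 (unitBall N) u) (hrad : IsRadial u) :
    let G := sphericalMean volume (radialComponent (weakGradient (unitBall N) u))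
    ∃ c, ContinuousOn (fun r => c + ∫ t in (1 / 2 : ℝ)..r, G t) (Ioc 0 1) ∧
      ∀ᵐ x ∂(volume.restrict (unitBall N)), u x = c + ∫ t in (1 / 2 : ℝ)..‖x‖, G t := by
  intro G
  have hfin : IsFiniteMeasure ((volume : Measure (EuclideanSpace ℝ (Fin N))).restrict
      (unitBall N)) := ⟨by simpa using measure_ball_lt_top⟩
  set g := weakGradient (unitBall N) u
  have hui : IntegrableOn u (unitBall N) := hu.1.integrable (by norm_num)
  have hg2 := hu.memLp_weakGradient isOpen_ball
  have hgi : IntegrableOn g (unitBall N) := hg2.integrable (by norm_num)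
  have hri : IntegrableOn (radialComponent g) (unitBall N) :=
    (memLp_radialComponent hg2).integrable (by norm_num)
  have hsub : {x : EuclideanSpace ℝ (Fin N) | ‖x‖ ∈ Ioo (0 : ℝ) 1} ⊆ unitBall N := fun x hx => by
    simpa using hx.2
  have hGl : LocallyIntegrableOn G (Ioo 0 1) :=
    locallyIntegrableOn_sphericalMean (hri.mono_set hsub)
  obtain ⟨c, hc⟩ := ae_eq_const_add_primitive
    (locallyIntegrableOn_sphericalMean (hui.mono_set hsub)) hGl
    (fun ψ hψ _ hs => hu.hasWeakGradient.integral_sphericalMean_mul_deriv hN hui hgi hψ hs)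
  have hGi : IntegrableOn G (Ioo (1 / 2) 1) := by
    have h1 := integrableOn_sphericalMean volume (E := EuclideanSpace ℝ (Fin N))
      measurableSet_Ioo Ioo_zero_one_subset_Ioi (hri.mono_set hsub)
    rw [finrank_euclideanSpace_fin] at h1
    have h2 := (h1.mono_set (Ioo_subset_Ioo_left (by norm_num : (0 : ℝ) ≤ 1 / 2)))
    have h3 := h2.continuousOn_mul_of_subset (K := Icc (1 / 2) 1)
      (g := fun r : ℝ => (r ^ (N - 1))⁻¹) ((continuousOn_pow _).inv₀ fun r hr =>
        pow_ne_zero _ (by linarith [hr.1] : (0 : ℝ) < r).ne') isCompact_Icc measurableSet_Ioo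
        Ioo_subset_Icc_self
    refine h3.congr_fun (fun r hr => ?_) measurableSet_Ioo
    simp only
    rw [inv_mul_cancel_left₀ (pow_ne_zero _ (by linarith [hr.1] : (0 : ℝ) < r).ne')]
  refine ⟨c, continuousOn_const.add (continuousOn_primitive_Ioc hGl hGi), ?_⟩
  obtain ⟨w₀, hw₀⟩ := hrad
  rw [restrict_unitBall] at hw₀ ⊢
  have h1 := sphericalMean_of_radial volume measurableSet_Ioo Ioo_zero_one_subset_Ioi hw₀
  have h2 : ∀ᵐ r ∂(volume.restrict (Ioo (0 : ℝ) 1)),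
      w₀ r = c + ∫ t in (1 / 2 : ℝ)..r, G t := by
    filter_upwards [h1, hc] with r h1 h2
    rw [← h1, h2]
  have h3 := (ae_norm_iff (volume : Measure (EuclideanSpace ℝ (Fin N))) measurableSet_Ioo
    Ioo_zero_one_subset_Ioi (P := fun r => w₀ r = c + ∫ t in (1 / 2 : ℝ)..r, G t)).2 h2
  filter_upwards [hw₀, h3] with x hx1 hx2
  rw [hx1, hx2]

/-- Bootstrap: `w` is continuous, so the right-hand side `H` is continuous, so `r ^ (N - 1) G`
agrees almost everywhere with a `C¹` function `Z`; then `p = Z / r ^ (N - 1)` is a genuine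
derivative of `w`. The norm bound is only an inequality, since it uses Jensen and `|∂ᵣ u| ≤ |∇u|`.
-/
theorem exists_isRadialSolution (hN : 0 < N) (hf : Continuous f) (hu : MemH1 (unitBall N) u)
    (hrad : IsRadial u) (hsol : IsWeakSolution α f u) :
    ∃ w p : ℝ → ℝ, IsRadialSolution N α f w p ∧
      (∀ᵐ x ∂(volume.restrict (unitBall N)), u x = w ‖x‖) ∧
      sphereArea (volume : Measure (EuclideanSpace ℝ (Fin N))) *
        ((∫ r in Ioo (1 / 2) 1, r ^ (N - 1) * w r ^ 2) +
          ∫ r in Ioo (1 / 2) 1, r ^ (N - 1) * p r ^ 2) ≤ h1Norm (annulus N) u ^ 2 := by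
  have hfin : IsFiniteMeasure ((volume : Measure (EuclideanSpace ℝ (Fin N))).restrict
      (unitBall N)) := ⟨by simpa using measure_ball_lt_top⟩
  obtain ⟨c, hwc, hwu⟩ := hu.exists_primitive hN hrad
  set g := weakGradient (unitBall N) u
  set G := sphericalMean volume (radialComponent g)
  set w : ℝ → ℝ := fun r => c + ∫ t in (1 / 2 : ℝ)..r, G t with hw
  have hg2 := hu.memLp_weakGradient isOpen_ball
  have hgi : IntegrableOn g (unitBall N) := hg2.integrable (by norm_num)
  have hr2 := memLp_radialComponent hg2
  have hri : IntegrableOn (radialComponent g) (unitBall N) := hr2.integrable (by norm_num)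
  have hri2 : IntegrableOn (fun x => radialComponent g x ^ 2) (unitBall N) := hr2.integrable_sq
  have hsub : {x : EuclideanSpace ℝ (Fin N) | ‖x‖ ∈ Ioo (0 : ℝ) 1} ⊆ unitBall N := fun x hx => by
    simpa using hx.2
  have hGl : LocallyIntegrableOn G (Ioo 0 1) :=
    locallyIntegrableOn_sphericalMean (hri.mono_set hsub)
  set H : ℝ → ℝ := fun r => r ^ (N - 1) * (r ^ α * f (w r)) with hH
  have hwc' : ContinuousOn w (Ioo 0 1) := hwc.mono Ioo_subset_Ioc_self
  have hHc : ContinuousOn H (Ioo 0 1) :=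
    (continuousOn_pow _).mul ((continuousOn_id.rpow_const fun r hr => Or.inl hr.1.ne').mul
      (hf.comp_continuousOn hwc'))
  obtain ⟨c', hc'⟩ := ae_eq_const_add_primitive (V := fun r => r ^ (N - 1) * G r)
    (H := fun r => - H r)
    (hGl.continuousOn_mul (continuousOn_pow _) isOpen_Ioo.isLocallyClosed)
    (hHc.neg.locallyIntegrableOn measurableSet_Ioo) (fun ψ hψ _ hs => by
      have := hsol.integral_sphericalMean_mul_deriv (w := w) hgi hwu
        (hψ.of_le (by exact_mod_cast le_top)) hs
      rw [this, ← integral_neg]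
      simp only [hH, neg_mul, neg_neg])
  set Z : ℝ → ℝ := fun r => c' + ∫ t in (1 / 2 : ℝ)..r, - H t with hZ
  set p : ℝ → ℝ := fun r => Z r * (r ^ (N - 1))⁻¹ with hp
  have hZd : ∀ r ∈ Ioo (0 : ℝ) 1, HasDerivAt Z (- H r) r := fun r hr => by
    exact (hasDerivAt_primitive_Ioo hHc.neg hr).const_add c'
  have hGp : ∀ᵐ r ∂(volume.restrict (Ioo (0 : ℝ) 1)), G r = p r := by
    filter_upwards [hc', ae_restrict_mem measurableSet_Ioo] with r hr hrm
    have : r ^ (N - 1) ≠ 0 := pow_ne_zero _ hrm.1.ne'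
    simp only [hp, hZ]
    rw [← hr]
    field_simp
  have hpd : ∀ r ∈ Ioo (0 : ℝ) 1, HasDerivAt p (-((N - 1) / r * p r) - r ^ α * f (w r)) r := by
    intro r hr
    have hr0 : r ≠ 0 := hr.1.ne'
    have hrn : r ^ (N - 1) ≠ 0 := pow_ne_zero _ hr0
    have d := (hZd r hr).fun_mul ((hasDerivAt_pow (N - 1) r).fun_inv hrn)
    convert! d using 1
    simp only [hp, hH]
    have e1 : ((N - 1 : ℕ) : ℝ) = N - 1 := by
      rw [Nat.cast_sub hN]
      simp
    rw [e1]
    -- For `N = 1` the exponent `N - 1 - 1` is truncated to `0`, so that case is separate.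
    rcases Nat.lt_or_ge 1 N with h1 | h1
    · have e2 : r ^ (N - 1) = r ^ (N - 1 - 1) * r := by
        rw [← pow_succ, Nat.sub_add_cancel (by omega)]
      have hrn' : r ^ (N - 1 - 1) ≠ 0 := pow_ne_zero _ hr0
      rw [e2]
      field_simp
      ring
    · have : N = 1 := by omega
      subst this
      simp
  have hpc : ContinuousOn p (Ioo 0 1) := fun r hr =>
    (hpd r hr).continuousAt.continuousWithinAt
  have hwp : ∀ r ∈ Ioo (0 : ℝ) 1, w r = c + ∫ t in (1 / 2 : ℝ)..r, p t := by
    intro r hr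
    simp only [hw]
    congr 1
    refine intervalIntegral.integral_congr_ae ?_
    rw [ae_restrict_iff' measurableSet_Ioo] at hGp
    filter_upwards [hGp] with t ht htm
    exact ht (OrdConnected.uIcc_subset ordConnected_Ioo ⟨by norm_num, by norm_num⟩ hr
      (uIoc_subset_uIcc htm))
  have hwd : ∀ r ∈ Ioo (0 : ℝ) 1, HasDerivAt w (p r) r := fun r hr => by
    refine ((hasDerivAt_primitive_Ioo hpc hr).const_add c).congr_of_eventuallyEq ?_
    filter_upwards [isOpen_Ioo.mem_nhds hr] with t ht using hwp t ht
  have hint : IntegrableOn (fun r => r ^ (N - 1) * p r ^ 2) (Ioo 0 1) := by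
    have h1 := integrableOn_sq_sphericalMean volume (E := EuclideanSpace ℝ (Fin N))
      measurableSet_Ioo Ioo_zero_one_subset_Ioi (hri.mono_set hsub) (hri2.mono_set hsub)
    rw [finrank_euclideanSpace_fin] at h1
    refine h1.congr ?_
    filter_upwards [hGp] with r hr
    change r ^ (N - 1) * G r ^ 2 = _
    rw [hr]
  refine ⟨w, p, ⟨hwc, hwd, hpd, hint⟩, hwu, ?_⟩
  have hA0 : Ioo (1 / 2 : ℝ) 1 ⊆ Ioi 0 := fun r hr => by
    have := hr.1
    exact lt_trans (by norm_num) this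
  have hAsub : {x : EuclideanSpace ℝ (Fin N) | ‖x‖ ∈ Ioo (1 / 2 : ℝ) 1} ⊆ unitBall N :=
    fun x hx => by simpa using hx.2
  have e1 : ∫ x in annulus N, u x ^ 2 =
      sphereArea (volume : Measure (EuclideanSpace ℝ (Fin N))) *
        ∫ r in Ioo (1 / 2) 1, r ^ (N - 1) * w r ^ 2 := by
    have e := integral_radial (μ := volume) (E := EuclideanSpace ℝ (Fin N)) measurableSet_Ioo
      hA0 (fun r => w r ^ 2)
    rw [finrank_euclideanSpace_fin] at e
    rw [← e, ← annulus_eq]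
    refine integral_congr_ae ?_
    filter_upwards [hwu.filter_mono (ae_mono (Measure.restrict_mono annulus_subset le_rfl))]
      with x hx
    rw [hx]
  have e2 : ∫ x in annulus N, ‖weakGradient (annulus N) u x‖ ^ 2 = ∫ x in annulus N, ‖g x‖ ^ 2 := by
    refine integral_congr_ae ?_
    filter_upwards [hu.weakGradient_ae_eq isOpen_annulus annulus_subset] with x hx
    rw [hx]
  have e3 : sphereArea (volume : Measure (EuclideanSpace ℝ (Fin N))) *
      ∫ r in Ioo (1 / 2) 1, r ^ (N - 1) * p r ^ 2 ≤ ∫ x in annulus N, ‖g x‖ ^ 2 := by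
    have h1 := integral_sq_sphericalMean_le volume (E := EuclideanSpace ℝ (Fin N))
      measurableSet_Ioo hA0 (hri.mono_set hAsub) (hri2.mono_set hAsub)
    rw [finrank_euclideanSpace_fin, ← annulus_eq] at h1
    have h2 : ∫ x in annulus N, radialComponent g x ^ 2 ≤ ∫ x in annulus N, ‖g x‖ ^ 2 := by
      refine integral_mono_ae (IntegrableOn.mono_set hri2 annulus_subset) ?_ ?_
      · exact IntegrableOn.mono_set (hg2.integrable_norm_pow two_ne_zero) annulus_subset
      · refine Filter.Eventually.of_forall fun x => ?_
        have := norm_radialComponent_le g x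
        simp only
        rw [← sq_abs]
        exact pow_le_pow_left₀ (abs_nonneg _) this 2
    refine le_trans (le_of_eq ?_) (h1.trans h2)
    congr 1
    refine integral_congr_ae ?_
    have hGp' := hGp.filter_mono (ae_mono (Measure.restrict_mono
      (Ioo_subset_Ioo_left (by norm_num : (0 : ℝ) ≤ 1 / 2)) le_rfl))
    filter_upwards [hGp'] with r hr
    change _ = r ^ (N - 1) * G r ^ 2
    rw [hr]
  rw [h1Norm, Real.sq_sqrt (add_nonneg (integral_nonneg fun _ => sq_nonneg _)
    (integral_nonneg fun _ => sq_nonneg _)), mul_add, e1, e2]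
  exact add_le_add_right e3 _

end Profile

/-! ### Stability tested with the rescaled derivative of the profile. -/

theorem contDiffOn_one_of_hasDerivAt {q Q : ℝ → ℝ} {s : Set ℝ} (hs : IsOpen s)
    (hq : ∀ r ∈ s, HasDerivAt q (Q r) r) (hQ : ContinuousOn Q s) : ContDiffOn ℝ 1 q s := by
  rw [show (1 : WithTop ℕ∞) = 0 + 1 from (zero_add 1).symm, contDiffOn_succ_iff_deriv_of_isOpen hs]
  refine ⟨fun r hr => (hq r hr).differentiableAt.differentiableWithinAt, by simp, ?_⟩
  rw [contDiffOn_zero]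
  exact hQ.congr fun r hr => (hq r hr).deriv

/-- The integral of the derivative of a function compactly supported in `(0, 1)` vanishes. -/
theorem setIntegral_deriv_eq_zero {F F' : ℝ → ℝ} {a b : ℝ} (ha : 0 < a) (hab : a ≤ b) (hb : b < 1)
    (hF : ∀ r ∈ Ioo (0 : ℝ) 1, HasDerivAt F (F' r) r) (hF' : ContinuousOn F' (Ioo 0 1))
    (h0 : ∀ r, r ∉ Icc a b → F r = 0) (h0' : ∀ r, r ∉ Icc a b → F' r = 0) :
    ∫ r in Ioo 0 1, F' r = 0 := by
  have hsub : uIcc (a / 2) ((1 + b) / 2) ⊆ Ioo 0 1 :=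
    OrdConnected.uIcc_subset ordConnected_Ioo ⟨by linarith, by linarith⟩
      ⟨by linarith, by linarith⟩
  rw [setIntegral_Ioo_eq_intervalIntegral (a := a / 2) (b := (1 + b) / 2) (by linarith)
      (by linarith) (by linarith) (fun r hr => h0' r fun h => hr
        ⟨by linarith [h.1], by linarith [h.2]⟩),
    intervalIntegral.integral_eq_sub_of_hasDerivAt (fun r hr => hF r (hsub hr))
      (hF'.mono hsub).intervalIntegrable,
    h0 ((1 + b) / 2) (fun h => by linarith [h.2]), h0 (a / 2) (fun h => by linarith [h.1]),
    sub_zero]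

/-- The square `(α + 2)(α + 2N - 2) / 4` of the rate of growth. -/
noncomputable def growthSq (N : ℕ) (α : ℝ) : ℝ := (N - 1 + α / 2) * (1 + α / 2)

/-- The derivative of `r ^ (-α / 2) w'`. -/
noncomputable def derivRescaled (N : ℕ) (α : ℝ) (f w p : ℝ → ℝ) (r : ℝ) : ℝ :=
  -(r ^ (α / 2) * f (w r)) - (N - 1 + α / 2) * (p r / (r ^ (α / 2) * r))

section Energy

variable {N : ℕ} {α : ℝ} {f w p : ℝ → ℝ}

theorem hasDerivAt_rpow_half {r : ℝ} (hr : 0 < r) :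
    HasDerivAt (fun r : ℝ => r ^ (α / 2)) (α / 2 * (r ^ (α / 2) / r)) r := by
  have := Real.hasDerivAt_rpow_const (x := r) (p := α / 2) (Or.inl hr.ne')
  rwa [Real.rpow_sub_one hr.ne'] at this

theorem rpow_eq_sq_half {r : ℝ} (hr : 0 < r) : r ^ α = (r ^ (α / 2)) ^ 2 := by
  rw [← Real.rpow_natCast, ← Real.rpow_mul hr.le]
  norm_num

theorem IsRadialSolution.hasDerivAt_rescaled (h : IsRadialSolution N α f w p) {r : ℝ}
    (hr : r ∈ Ioo (0 : ℝ) 1) :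
    HasDerivAt (fun r => p r / r ^ (α / 2)) (derivRescaled N α f w p r) r := by
  have ha : 0 < r ^ (α / 2) := Real.rpow_pos_of_pos hr.1 _
  have hr0 : r ≠ 0 := hr.1.ne'
  convert! (h.hasDerivAt_deriv r hr).fun_div (hasDerivAt_rpow_half (α := α) hr.1) ha.ne' using 1
  rw [derivRescaled, rpow_eq_sq_half (α := α) hr.1]
  generalize r ^ (α / 2) = a at ha ⊢
  field_simp
  ring

/-- The linearised equation for `q = r ^ (-α / 2) w'`. The terms in `f(w)` cancel thanks to the
factor `r ^ (-α / 2)`, and what remains of the rescaling is the inverse-square term with coefficient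
`growthSq`. -/
theorem IsRadialSolution.hasDerivAt_derivRescaled (hf : ContDiff ℝ 1 f)
    (h : IsRadialSolution N α f w p) {r : ℝ} (hr : r ∈ Ioo (0 : ℝ) 1) :
    HasDerivAt (derivRescaled N α f w p)
      (-((N - 1) / r) * derivRescaled N α f w p r
        - r ^ α * deriv f (w r) * (p r / r ^ (α / 2))
        + growthSq N α * (p r / r ^ (α / 2)) / r ^ 2) r := by
  have ha : 0 < r ^ (α / 2) := Real.rpow_pos_of_pos hr.1 _
  have hr0 : r ≠ 0 := hr.1.ne'
  have d0 := hasDerivAt_rpow_half (α := α) hr.1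
  have d1 : HasDerivAt (fun r => f (w r)) (deriv f (w r) * p r) r :=
    ((hf.differentiable (by simp) (w r)).hasDerivAt).comp r (h.hasDerivAt r hr)
  have d2 := (h.hasDerivAt_deriv r hr).fun_div (d0.fun_mul (hasDerivAt_id r))
    (mul_ne_zero ha.ne' hr0)
  have d3 := (d0.fun_mul d1).fun_neg.fun_sub (d2.const_mul ((N : ℝ) - 1 + α / 2))
  convert! d3 using 1
  simp only [derivRescaled, growthSq, id]
  rw [rpow_eq_sq_half (α := α) hr.1]
  clear d0 d2 d3
  generalize r ^ (α / 2) = a at ha ⊢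
  field_simp
  ring

theorem IsRadialSolution.continuousOn_derivRescaled (hf : ContDiff ℝ 1 f)
    (h : IsRadialSolution N α f w p) : ContinuousOn (derivRescaled N α f w p) (Ioo 0 1) :=
  fun _ hr => (h.hasDerivAt_derivRescaled hf hr).continuousAt.continuousWithinAt

/-- Stability tested with `r ^ (-α / 2) w' η`. -/
theorem IsRadialSolution.integral_nonneg_of_stable (hf : ContDiff ℝ 1 f)
    (h : IsRadialSolution N α f w p)
    (hst : ∀ ψ : ℝ → ℝ, ContDiff ℝ 1 ψ → tsupport ψ ⊆ Ioo 0 1 →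
      0 ≤ ∫ r in Ioo 0 1, r ^ (N - 1) * (deriv ψ r ^ 2 - r ^ α * deriv f (w r) * ψ r ^ 2))
    (hN : 0 < N) {η : ℝ → ℝ} (hη : ContDiff ℝ 1 η) (hc : HasCompactSupport η)
    (hs : tsupport η ⊆ Ioo 0 1) :
    IntegrableOn (fun r => r ^ (N - 1) * (p r / r ^ (α / 2)) ^ 2 *
      (deriv η r ^ 2 - growthSq N α * η r ^ 2 / r ^ 2)) (Ioo 0 1) ∧
    0 ≤ ∫ r in Ioo 0 1, r ^ (N - 1) * (p r / r ^ (α / 2)) ^ 2 *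
      (deriv η r ^ 2 - growthSq N α * η r ^ 2 / r ^ 2) := by
  set q : ℝ → ℝ := fun r => p r / r ^ (α / 2) with hq
  set Q := derivRescaled N α f w p with hQ
  have hqd : ∀ r ∈ Ioo (0 : ℝ) 1, HasDerivAt q (Q r) r := fun r hr => h.hasDerivAt_rescaled hr
  have hQc : ContinuousOn Q (Ioo 0 1) := h.continuousOn_derivRescaled hf
  have hqc : ContinuousOn q (Ioo 0 1) := fun r hr =>
    (hqd r hr).continuousAt.continuousWithinAt
  set φ : ℝ → ℝ := fun r => η r * q r with hφ
  have hφd : ContDiff ℝ 1 φ := contDiff_mul_of_contDiffOn (n := 1) hη hs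
    (contDiffOn_one_of_hasDerivAt isOpen_Ioo hqd hQc)
  have hφs : tsupport φ ⊆ Ioo 0 1 := tsupport_mul_subset_Ioo hs
  have hηc : Continuous (deriv η) := hη.continuous_deriv le_rfl
  obtain ⟨a, b, ha, ha', hb', hb, hab⟩ := exists_Icc_of_isCompact hc hs
  have hpow : ContinuousOn (fun r : ℝ => r ^ (N - 1)) (Ioo 0 1) := continuousOn_pow _
  have hrα : ContinuousOn (fun r : ℝ => r ^ α) (Ioo 0 1) :=
    continuousOn_id.rpow_const fun r hr => Or.inl hr.1.ne'
  have hf' : ContinuousOn (fun r => deriv f (w r)) (Ioo 0 1) :=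
    (hf.continuous_deriv le_rfl).comp_continuousOn h.continuousOn_Ioo
  set I₁ : ℝ → ℝ := fun r =>
    r ^ (N - 1) * (deriv φ r ^ 2 - r ^ α * deriv f (w r) * φ r ^ 2) with hI₁
  set I₂ : ℝ → ℝ := fun r => r ^ (N - 1) * q r ^ 2 *
      (deriv η r ^ 2 - growthSq N α * η r ^ 2 / r ^ 2) with hI₂
  have hI₁c : ContinuousOn I₁ (Ioo 0 1) :=
    hpow.mul (((hφd.continuous_deriv le_rfl).continuousOn.pow 2).sub
      ((hrα.mul hf').mul (hφd.continuous.continuousOn.pow 2)))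
  have hI₂c : ContinuousOn I₂ (Ioo 0 1) :=
    (hpow.mul (hqc.pow 2)).mul ((hηc.continuousOn.pow 2).sub
      ((continuousOn_const.mul (hη.continuous.continuousOn.pow 2)).div (continuousOn_pow _)
        fun r hr => pow_ne_zero _ hr.1.ne'))
  have hη0 : ∀ r, r ∉ Icc a b → η r = 0 := fun r hr => eq_zero_of_notMem_Icc hab hr
  have hη0' : ∀ r, r ∉ Icc a b → deriv η r = 0 := fun r hr => deriv_eq_zero_of_notMem_Icc hab hr
  have hφab : tsupport φ ⊆ Icc a b :=
    (tsupport_mul_subset_left (f := η) (g := q)).trans hab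
  have hI₁0 : ∀ r, r ∉ Icc a b → I₁ r = 0 := fun r hr => by
    simp [hI₁, eq_zero_of_notMem_Icc hφab hr, deriv_eq_zero_of_notMem_Icc hφab hr]
  have hI₂0 : ∀ r, r ∉ Icc a b → I₂ r = 0 := fun r hr => by
    simp [hI₂, hη0 r hr, hη0' r hr]
  have hsubI : Icc a b ⊆ Ioo 0 1 := fun r hr => ⟨ha.trans_le hr.1, hr.2.trans_lt hb⟩
  have hi : ∀ I : ℝ → ℝ, ContinuousOn I (Ioo 0 1) → (∀ r, r ∉ Icc a b → I r = 0) →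
      IntegrableOn I (Ioo 0 1) := fun I hI h0 =>
    ((integrableOn_iff_integrable_of_support_subset (fun r hr => by_contra fun h => hr (h0 r h))).1
      ((hI.mono hsubI).integrableOn_compact isCompact_Icc)).integrableOn
  -- By the linearised equation the two integrands differ by the exact derivative of `r ^ (N - 1) q
  -- q' η²`.
  have hF : ∫ r in Ioo 0 1, (I₁ r - I₂ r) = 0 := by
    refine setIntegral_deriv_eq_zero (F := fun r => r ^ (N - 1) * Q r * q r * η r ^ 2) ha
      (by linarith) hb ?_ (hI₁c.sub hI₂c) ?_ ?_
    · intro r hr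
      have hr0 : r ≠ 0 := hr.1.ne'
      have d := (((hasDerivAt_pow (N - 1) r).fun_mul
        (h.hasDerivAt_derivRescaled hf hr)).fun_mul (hqd r hr)).fun_mul
        ((hη.differentiable (by simp) r).hasDerivAt.fun_pow 2)
      convert! d using 1
      have dφ : deriv φ r = deriv η r * q r + η r * Q r :=
        ((hη.differentiable (by simp) r).hasDerivAt.fun_mul (hqd r hr)).deriv
      simp only [hI₁, hI₂, dφ]
      simp only [hφ, ← hQ]
      rw [show p r / r ^ (α / 2) = q r from rfl]
      have e1 : ((N - 1 : ℕ) : ℝ) = N - 1 := by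
        rw [Nat.cast_sub hN]
        simp
      rw [e1]
      rcases Nat.lt_or_ge 1 N with h1 | h1
      · have e2 : r ^ (N - 1) = r ^ (N - 1 - 1) * r := by
          rw [← pow_succ, Nat.sub_add_cancel (by omega)]
        rw [e2]
        field_simp
        ring
      · have : N = 1 := by omega
        subst this
        simp
        field_simp
        ring
    · intro r hr
      simp [hη0 r hr]
    · intro r hr
      simp [hI₁0 r hr, hI₂0 r hr]
  rw [integral_sub (hi _ hI₁c hI₁0) (hi _ hI₂c hI₂0)] at hF
  have := hst φ hφd hφs
  exact ⟨hi _ hI₂c hI₂0, by linarith⟩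

end Energy

/-! ### The test function: interpolated powers and cutoffs. -/

section Power

theorem rpow_le_of_mem_Icc_half {R t : ℝ} (hR : 0 < R) (ht : t ∈ Icc (R / 2) R) (s : ℝ) :
    t ^ s ≤ 2 ^ |s| * R ^ s := by
  have ht0 : 0 < t := by linarith [ht.1]
  have h1 : t = R * (t / R) := by field_simp
  have h2 : 1 / 2 ≤ t / R := by
    rw [le_div_iff₀ hR]
    linarith [ht.1]
  have h3 : t / R ≤ 1 := (div_le_one hR).2 ht.2
  have h4 : (t / R) ^ s ≤ 2 ^ |s| := by
    rcases le_total 0 s with hs | hs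
    · calc (t / R) ^ s ≤ 1 := Real.rpow_le_one (by positivity) h3 hs
        _ ≤ 2 ^ |s| := Real.one_le_rpow (by norm_num) (abs_nonneg s)
    · calc (t / R) ^ s ≤ (1 / 2) ^ s := Real.rpow_le_rpow_of_nonpos (by norm_num) h2 hs
        _ = 2 ^ |s| := by
          rw [one_div, Real.inv_rpow (by norm_num), abs_of_nonpos hs,
            Real.rpow_neg (by norm_num)]
  calc t ^ s = R ^ s * (t / R) ^ s := by
        rw [← Real.mul_rpow hR.le (by positivity), ← h1]
    _ ≤ R ^ s * 2 ^ |s| := by gcongr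
    _ = 2 ^ |s| * R ^ s := mul_comm _ _

theorem le_rpow_of_mem_Icc_half {R t : ℝ} (hR : 0 < R) (ht : t ∈ Icc (R / 2) R) (s : ℝ) :
    R ^ s ≤ 2 ^ |s| * t ^ s := by
  have ht0 : 0 < t := by linarith [ht.1]
  have h := rpow_le_of_mem_Icc_half hR ht (-s)
  rw [abs_neg, Real.rpow_neg ht0.le, Real.rpow_neg hR.le, ← div_eq_mul_inv,
    inv_le_iff_one_le_mul₀ (by positivity), div_mul_eq_mul_div,
    one_le_div (by positivity)] at h
  exact h

end Power

section Interpolation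

variable {k b R t : ℝ}

/-- A function interpolating between the powers `t ^ k` for `t ≪ R` and `t ^ (-b)` for `t ≫ R`. -/
noncomputable def powInterp (k b R t : ℝ) : ℝ := t ^ k / (R ^ (k + b) + t ^ (k + b))

/-- The logarithmic derivative `t E'(t) / E(t)` of `E = powInterp k b R`. -/
noncomputable def powInterpRate (k b R t : ℝ) : ℝ :=
  k - (k + b) * (t ^ (k + b) / (R ^ (k + b) + t ^ (k + b)))

theorem powInterp_pos (hR : 0 < R) (ht : 0 < t) : 0 < powInterp k b R t := by
  unfold powInterp
  positivity

theorem hasDerivAt_powInterp (hR : 0 < R) (ht : 0 < t) :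
    HasDerivAt (powInterp k b R) (powInterp k b R t * powInterpRate k b R t / t) t := by
  have h1 := Real.hasDerivAt_rpow_const (x := t) (p := k) (Or.inl ht.ne')
  have h2 := Real.hasDerivAt_rpow_const (x := t) (p := k + b) (Or.inl ht.ne')
  rw [Real.rpow_sub_one ht.ne'] at h1 h2
  have hpos : 0 < R ^ (k + b) + t ^ (k + b) := by positivity
  convert! h1.fun_div (h2.const_add (R ^ (k + b))) hpos.ne' using 1
  simp only [powInterp, powInterpRate]
  generalize R ^ (k + b) = X at *
  generalize t ^ (k + b) = T at *
  generalize t ^ k = K at *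
  field_simp

theorem contDiffOn_powInterp (hR : 0 < R) : ContDiffOn ℝ 1 (powInterp k b R) (Ioo 0 1) := by
  intro t ht
  have h1 : ∀ s : ℝ, ContDiffAt ℝ 1 (fun t : ℝ => t ^ s) t := fun s =>
    Real.contDiffAt_rpow_const_of_ne ht.1.ne'
  have ht0 := ht.1
  have hpos : 0 < R ^ (k + b) + t ^ (k + b) := by positivity
  exact ((h1 k).div (contDiffAt_const.add (h1 (k + b))) hpos.ne').contDiffWithinAt

/-- The rate is a convex combination of `k` and `-b`. As `E'² - b² E² / t² = (rate² - b²) E² / t²`,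
this bound makes the Hardy form nonpositive. -/
theorem abs_powInterpRate_le (hk : 0 ≤ k) (hkb : k ≤ b) (hR : 0 < R) (ht : 0 < t) :
    |powInterpRate k b R t| ≤ b := by
  have h1 : t ^ (k + b) / (R ^ (k + b) + t ^ (k + b)) ≤ 1 := by
    rw [div_le_one (by positivity)]
    have : 0 < R ^ (k + b) := by positivity
    linarith
  have h2 : 0 ≤ t ^ (k + b) / (R ^ (k + b) + t ^ (k + b)) := by positivity
  rw [powInterpRate, abs_le]
  constructor <;> nlinarith

theorem powInterp_le_left (hR : 0 < R) (ht : 0 < t) :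
    powInterp k b R t ≤ t ^ k / R ^ (k + b) := by
  unfold powInterp
  have : 0 < t ^ (k + b) := by positivity
  gcongr
  linarith

theorem powInterp_le_right (hR : 0 < R) (ht : 0 < t) : powInterp k b R t ≤ t ^ (-b) := by
  have : 0 < R ^ (k + b) := by positivity
  calc powInterp k b R t ≤ t ^ k / t ^ (k + b) := by
        unfold powInterp
        gcongr
        linarith
    _ = t ^ (-b) := by
        rw [← Real.rpow_sub ht]
        congr 1
        ring

/-- For `t` comparable to `R` both weights of the convex combination are bounded below, so the rate
stays away from `-b` and `b`, while `E / t` is at least of order `R ^ (-b - 1)`. -/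
theorem exists_le_powInterp (hk : 0 < k) (hkb : k ≤ b) :
    ∃ c, 0 < c ∧ ∀ R t : ℝ, 0 < R → t ∈ Icc (R / 2) R →
      c * R ^ (-(2 * b + 2)) ≤
        powInterp k b R t ^ 2 / t ^ 2 * (b ^ 2 - powInterpRate k b R t ^ 2) := by
  have hb : 0 < b := hk.trans_le hkb
  refine ⟨((2 ^ k)⁻¹ / 2) ^ 2 * ((k + b) ^ 2 * ((2 ^ (k + b))⁻¹ / 2 * (1 / 2))), by positivity,
    fun R t hR ht => ?_⟩
  have ht0 : 0 < t := by linarith [ht.1]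
  have hX : 0 < R ^ (k + b) := by positivity
  have hT : 0 < t ^ (k + b) := by positivity
  have hTX : t ^ (k + b) ≤ R ^ (k + b) := Real.rpow_le_rpow ht0.le ht.2 (by linarith)
  have hXT := le_rpow_of_mem_Icc_half hR ht (k + b)
  have hKt := le_rpow_of_mem_Icc_half hR ht k
  rw [abs_of_pos (by linarith)] at hXT
  rw [abs_of_pos hk] at hKt
  set y := t ^ (k + b) / (R ^ (k + b) + t ^ (k + b)) with hy
  have hy1 : (2 ^ (k + b))⁻¹ / 2 ≤ y := by
    rw [hy, le_div_iff₀ (by positivity)]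
    calc (2 ^ (k + b))⁻¹ / 2 * (R ^ (k + b) + t ^ (k + b))
        ≤ (2 ^ (k + b))⁻¹ / 2 * (2 * R ^ (k + b)) := by gcongr; linarith
      _ = (2 ^ (k + b))⁻¹ * R ^ (k + b) := by ring
      _ ≤ (2 ^ (k + b))⁻¹ * (2 ^ (k + b) * t ^ (k + b)) := by gcongr
      _ = t ^ (k + b) := by rw [inv_mul_cancel_left₀ (by positivity)]
  have hy2 : 1 / 2 ≤ 1 - y := by
    have : y ≤ 1 / 2 := by
      rw [hy, div_le_iff₀ (by positivity)]
      linarith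
    linarith
  have hy0 : 0 < y := by
    rw [hy]
    positivity
  have h1 : (k + b) ^ 2 * ((2 ^ (k + b))⁻¹ / 2 * (1 / 2)) ≤
      b ^ 2 - powInterpRate k b R t ^ 2 := by
    -- The first summand is already bounded below, so `k = b` is allowed.
    have e : b ^ 2 - powInterpRate k b R t ^ 2
        = (k + b) ^ 2 * (y * (1 - y)) + (k + b) * (1 - y) * (b - k) := by
      rw [powInterpRate, ← hy]
      ring
    rw [e]
    have : 0 ≤ (k + b) * (1 - y) * (b - k) :=
      mul_nonneg (mul_nonneg (by linarith) (by linarith)) (by linarith)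
    have h2 : (2 ^ (k + b))⁻¹ / 2 * (1 / 2) ≤ y * (1 - y) := by gcongr
    nlinarith [mul_le_mul_of_nonneg_left h2 (sq_nonneg (k + b))]
  have h2 : (2 ^ k)⁻¹ / 2 * R ^ (-(b + 1)) ≤ powInterp k b R t / t := by
    have e : R ^ (-(b + 1)) = R ^ k / R ^ (k + b) / R := by
      rw [← Real.rpow_sub hR, ← Real.rpow_sub_one hR.ne']
      congr 1
      ring
    have h3 : R ^ k / 2 ^ k ≤ t ^ k := by
      rw [div_le_iff₀ (by positivity)]
      linarith
    calc (2 ^ k)⁻¹ / 2 * R ^ (-(b + 1)) = R ^ k / 2 ^ k / (2 * R ^ (k + b)) / R := by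
          rw [e]
          field_simp
      _ ≤ t ^ k / (R ^ (k + b) + t ^ (k + b)) / t := by
          gcongr
          · linarith
          · exact ht.2
      _ = powInterp k b R t / t := rfl
  have h3 : R ^ (-(2 * b + 2)) = (R ^ (-(b + 1))) ^ 2 := by
    rw [← Real.rpow_natCast, ← Real.rpow_mul hR.le]
    congr 1
    push_cast
    ring
  rw [h3, ← div_pow]
  calc _ = ((2 ^ k)⁻¹ / 2 * R ^ (-(b + 1))) ^ 2 *
        ((k + b) ^ 2 * ((2 ^ (k + b))⁻¹ / 2 * (1 / 2))) := by ring
    _ ≤ _ := by gcongr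

end Interpolation

section Cutoff

/-- A cutoff function supported in `[ε, 7 / 8]`, equal to `1` on `[2ε, 3 / 4]`. -/
noncomputable def cutoff (ε t : ℝ) : ℝ :=
  Real.smoothTransition (t / ε - 1) * Real.smoothTransition (7 - 8 * t)

theorem exists_bound_deriv_smoothTransition :
    ∃ c, 0 < c ∧ ∀ x, |deriv Real.smoothTransition x| ≤ c := by
  have hd : ContDiff ℝ 1 Real.smoothTransition := Real.smoothTransition.contDiff
  obtain ⟨c, hc⟩ := (isCompact_Icc (a := (0 : ℝ)) (b := 1)).exists_bound_of_continuousOn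
    (hd.continuous_deriv le_rfl).continuousOn
  refine ⟨max c 1, lt_max_of_lt_right one_pos, fun x => ?_⟩
  by_cases hx : x ∈ Icc (0 : ℝ) 1
  · exact (hc x hx).trans (le_max_left _ _)
  · have : deriv Real.smoothTransition x = 0 := by
      rcases not_and_or.1 hx with h | h
      · have h1 : Real.smoothTransition =ᶠ[nhds x] fun _ => 0 := by
          filter_upwards [Iio_mem_nhds (not_le.1 h)] with y hy
          exact Real.smoothTransition.zero_of_nonpos (le_of_lt hy)
        rw [h1.deriv_eq, deriv_const]
      · have h1 : Real.smoothTransition =ᶠ[nhds x] fun _ => 1 := by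
          filter_upwards [Ioi_mem_nhds (not_le.1 h)] with y hy
          exact Real.smoothTransition.one_of_one_le (le_of_lt hy)
        rw [h1.deriv_eq, deriv_const]
    rw [this, abs_zero]
    exact le_max_of_le_right zero_le_one

variable {ε t : ℝ}

theorem contDiff_cutoff : ContDiff ℝ 1 (cutoff ε) := by
  unfold cutoff
  exact (Real.smoothTransition.contDiff.comp (by fun_prop)).mul
    (Real.smoothTransition.contDiff.comp (by fun_prop))

theorem tsupport_cutoff_subset (hε : 0 < ε) : tsupport (cutoff ε) ⊆ Icc ε (7 / 8) := by
  refine closure_minimal (fun t ht => ?_) isClosed_Icc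
  by_contra h
  refine ht ?_
  unfold cutoff
  rcases not_and_or.1 h with h | h
  · rw [Real.smoothTransition.zero_of_nonpos (x := t / ε - 1), zero_mul]
    rw [sub_nonpos, div_le_one hε]
    exact (not_le.1 h).le
  · rw [Real.smoothTransition.zero_of_nonpos (x := 7 - 8 * t), mul_zero]
    linarith [not_le.1 h]

theorem tsupport_cutoff_subset_Ioo (hε : 0 < ε) : tsupport (cutoff ε) ⊆ Ioo 0 1 :=
  (tsupport_cutoff_subset hε).trans fun t ht => ⟨hε.trans_le ht.1, ht.2.trans_lt (by norm_num)⟩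

theorem cutoff_nonneg : 0 ≤ cutoff ε t :=
  mul_nonneg (Real.smoothTransition.nonneg _) (Real.smoothTransition.nonneg _)

theorem cutoff_le_one : cutoff ε t ≤ 1 :=
  mul_le_one₀ (Real.smoothTransition.le_one _) (Real.smoothTransition.nonneg _)
    (Real.smoothTransition.le_one _)

theorem cutoff_eventually_eq_one (hε : 0 < ε) (ht : t ∈ Ioo (2 * ε) (3 / 4)) :
    cutoff ε =ᶠ[nhds t] fun _ => 1 := by
  filter_upwards [isOpen_Ioo.mem_nhds ht] with s hs
  rw [cutoff, Real.smoothTransition.one_of_one_le, Real.smoothTransition.one_of_one_le, one_mul]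
  · linarith [hs.2]
  · rw [le_sub_iff_add_le, le_div_iff₀ hε]
    linarith [hs.1]

theorem abs_deriv_cutoff_le_left {c : ℝ} (hc : ∀ x, |deriv Real.smoothTransition x| ≤ c)
    (hε : 0 < ε) (ht : t < 3 / 4) : |deriv (cutoff ε) t| ≤ c / ε := by
  have h1 : cutoff ε =ᶠ[nhds t] fun s => Real.smoothTransition (s / ε - 1) := by
    filter_upwards [Iio_mem_nhds ht] with s hs
    rw [cutoff, Real.smoothTransition.one_of_one_le (x := 7 - 8 * s), mul_one]
    linarith [show s < 3 / 4 from hs]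
  have hd : Differentiable ℝ Real.smoothTransition :=
    (Real.smoothTransition.contDiff (n := 1)).differentiable (by simp)
  have h2 := ((hd (t / ε - 1)).hasDerivAt).comp t
    (((hasDerivAt_id t).div_const ε).sub_const 1)
  rw [h1.deriv_eq, show (fun s => Real.smoothTransition (s / ε - 1)) =
    Real.smoothTransition ∘ fun s => id s / ε - 1 from rfl, h2.deriv, abs_mul, abs_div, abs_one,
    abs_of_pos hε, mul_one_div]
  gcongr
  exact hc _

theorem abs_deriv_cutoff_le_right {c : ℝ} (hc : ∀ x, |deriv Real.smoothTransition x| ≤ c)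
    (hε : 0 < ε) (ht : 2 * ε < t) : |deriv (cutoff ε) t| ≤ 8 * c := by
  have h1 : cutoff ε =ᶠ[nhds t] fun s => Real.smoothTransition (7 - 8 * s) := by
    filter_upwards [Ioi_mem_nhds ht] with s hs
    rw [cutoff, Real.smoothTransition.one_of_one_le (x := s / ε - 1), one_mul]
    rw [le_sub_iff_add_le, le_div_iff₀ hε]
    linarith [show 2 * ε < s from hs]
  have hd : Differentiable ℝ Real.smoothTransition :=
    (Real.smoothTransition.contDiff (n := 1)).differentiable (by simp)
  have h2 := ((hd (7 - 8 * t)).hasDerivAt).comp t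
    (((hasDerivAt_id t).const_mul 8).const_sub 7)
  rw [h1.deriv_eq, show (fun s => Real.smoothTransition (7 - 8 * s)) =
    Real.smoothTransition ∘ fun s => 7 - 8 * id s from rfl, h2.deriv, abs_mul]
  have := hc (7 - 8 * t)
  simp
  linarith

end Cutoff

/-! ### Decay of the energy at the origin. -/

section Energy

variable {N : ℕ} {α : ℝ} {f w p : ℝ → ℝ}

/-- Pointwise bounds for the quadratic form of the Hardy type inequality at the test function
`cutoff ε * powInterp k b R`. -/
theorem exists_quadratic_form_bounds {k b : ℝ} (hk : 0 < k) (hkb : k ≤ b) :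
    ∃ c₀ C₁ : ℝ, 0 < c₀ ∧ 0 < C₁ ∧ ∀ R : ℝ, 0 < R → R ≤ 1 / 2 → ∃ C₂, 0 ≤ C₂ ∧
      ∀ ε : ℝ, 0 < ε → 4 * ε ≤ R → ∀ t ∈ Ioo (0 : ℝ) 1,
        deriv (fun t => cutoff ε t * powInterp k b R t) t ^ 2
          - b ^ 2 * (cutoff ε t * powInterp k b R t) ^ 2 / t ^ 2 ≤
        (Ioo (R / 2) R).indicator (fun _ => -(c₀ * R ^ (-(2 * b + 2)))) t +
          ((Ico (1 / 2) 1).indicator (fun _ => C₁) t +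
            (Ioc 0 (2 * ε)).indicator (fun t => C₂ * t ^ (2 * k - 2)) t) := by
  obtain ⟨c₀, hc₀, hlow⟩ := exists_le_powInterp hk hkb
  obtain ⟨c, hc, hcd⟩ := exists_bound_deriv_smoothTransition
  have hb : 0 < b := hk.trans_le hkb
  -- The outer constant is independent of `R`, because `E ≤ t ^ (-b) ≤ 2 ^ b` for `t ≥ 1 / 2`. The
  -- inner constant may depend on `R` but not on `ε`.
  refine ⟨c₀, ((8 * c + 2 * b) * 2 ^ b) ^ 2, hc₀, by positivity, fun R hR hR2 =>
    ⟨((2 * c + b) / R ^ (k + b)) ^ 2, by positivity, fun ε hε hεR t ht => ?_⟩⟩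
  have ht0 := ht.1
  have hE := powInterp_pos (k := k) (b := b) hR ht0
  have hEd := hasDerivAt_powInterp (k := k) (b := b) hR ht0
  have hθ := abs_powInterpRate_le hk.le hkb hR ht0
  set E := powInterp k b R t with hEdef
  set θ := powInterpRate k b R t
  have hd : deriv (fun t => cutoff ε t * powInterp k b R t) t =
      deriv (cutoff ε) t * E + cutoff ε t * (E * θ / t) :=
    ((contDiff_cutoff.differentiable (by simp) t).hasDerivAt.fun_mul hEd).deriv
  rw [hd]
  have hκ0 : 0 ≤ cutoff ε t := cutoff_nonneg
  have hκ1 : cutoff ε t ≤ 1 := cutoff_le_one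
  have hneg : 0 ≤ b ^ 2 * (cutoff ε t * E) ^ 2 / t ^ 2 := by positivity
  have habs : ∀ M, |deriv (cutoff ε) t| ≤ M →
      (deriv (cutoff ε) t * E + cutoff ε t * (E * θ / t)) ^ 2 ≤ ((M + b / t) * E) ^ 2 := by
    intro M hM
    refine sq_le_sq' ?_ ?_ <;>
    · have h1 : |deriv (cutoff ε) t * E + cutoff ε t * (E * θ / t)| ≤ (M + b / t) * E := by
        calc |deriv (cutoff ε) t * E + cutoff ε t * (E * θ / t)|
            ≤ |deriv (cutoff ε) t * E| + |cutoff ε t * (E * θ / t)| := abs_add_le _ _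
          _ = |deriv (cutoff ε) t| * E + cutoff ε t * (E * |θ| / t) := by
              rw [abs_mul, abs_mul, abs_of_pos hE, abs_of_nonneg hκ0, abs_div, abs_mul,
                abs_of_pos hE, abs_of_pos ht0]
          _ ≤ M * E + 1 * (E * b / t) := by gcongr
          _ = (M + b / t) * E := by ring
      have := abs_le.1 h1
      linarith [this.1, this.2]
  -- Three zones: the inner cutoff `t ≤ 2ε`, which lies below `R / 2` as `4ε ≤ R`; the zone below `1
  -- / 2` where the cutoff is `1`; and `t ≥ 1 / 2`, which contains the outer cutoff.
  rcases le_or_gt t (2 * ε) with h2 | h2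
  · have hn1 : t ∉ Ioo (R / 2) R := fun h => by linarith [h.1]
    have hn2 : t ∉ Ico (1 / 2 : ℝ) 1 := fun h => by linarith [h.1]
    have hm : t ∈ Ioc 0 (2 * ε) := ⟨ht0, h2⟩
    rw [indicator_of_notMem hn1, indicator_of_notMem hn2, indicator_of_mem hm, zero_add, zero_add]
    have h3 := habs (c / ε) (abs_deriv_cutoff_le_left hcd hε (by linarith))
    -- As `t ≤ 2ε`, the slope of the cutoff is of order `1 / t`, which removes `ε` from the bound.
    have h4 : c / ε ≤ 2 * c / t := by
      rw [div_le_div_iff₀ hε ht0]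
      nlinarith
    have h5 : (c / ε + b / t) * E ≤ (2 * c + b) / R ^ (k + b) * t ^ (k - 1) := by
      calc (c / ε + b / t) * E ≤ (2 * c / t + b / t) * (t ^ k / R ^ (k + b)) := by
            gcongr
            exact powInterp_le_left hR ht0
        _ = (2 * c + b) / R ^ (k + b) * t ^ (k - 1) := by
            rw [Real.rpow_sub_one ht0.ne']
            ring
    have h6 : (t ^ (k - 1)) ^ 2 = t ^ (2 * k - 2) := by
      rw [← Real.rpow_natCast, ← Real.rpow_mul ht0.le]
      congr 1
      push_cast
      ring
    have h7 : ((c / ε + b / t) * E) ^ 2 ≤ ((2 * c + b) / R ^ (k + b) * t ^ (k - 1)) ^ 2 :=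
      pow_le_pow_left₀ (by positivity) h5 2
    rw [mul_pow ((2 * c + b) / R ^ (k + b)), h6] at h7
    linarith
  · have hn3 : t ∉ Ioc 0 (2 * ε) := fun h => absurd h.2 (not_le.2 h2)
    rw [indicator_of_notMem hn3, add_zero]
    rcases lt_or_ge t (1 / 2) with h3 | h3
    · have hn2 : t ∉ Ico (1 / 2 : ℝ) 1 := fun h => by linarith [h.1]
      have he := cutoff_eventually_eq_one hε (t := t) ⟨h2, by linarith⟩
      rw [indicator_of_notMem hn2, add_zero, he.deriv_eq, deriv_const, he.eq_of_nhds]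
      have e1 : (0 * E + 1 * (E * θ / t)) ^ 2 - b ^ 2 * (1 * E) ^ 2 / t ^ 2 =
          -(E ^ 2 / t ^ 2 * (b ^ 2 - θ ^ 2)) := by
        field_simp
        ring
      rw [e1]
      by_cases hm : t ∈ Ioo (R / 2) R
      · rw [indicator_of_mem hm]
        exact neg_le_neg (hlow R t hR ⟨hm.1.le, hm.2.le⟩)
      · rw [indicator_of_notMem hm, neg_nonpos]
        have : θ ^ 2 ≤ b ^ 2 := sq_le_sq' (abs_le.1 hθ).1 (abs_le.1 hθ).2
        have : 0 ≤ b ^ 2 - θ ^ 2 := by linarith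
        positivity
    · have hn1 : t ∉ Ioo (R / 2) R := fun h => by linarith [h.2]
      have hm : t ∈ Ico (1 / 2 : ℝ) 1 := ⟨h3, ht.2⟩
      rw [indicator_of_notMem hn1, indicator_of_mem hm, zero_add]
      have h4 := habs (8 * c) (abs_deriv_cutoff_le_right hcd hε h2)
      have h5 : (8 * c + b / t) * E ≤ (8 * c + 2 * b) * 2 ^ b := by
        have h6 : b / t ≤ 2 * b := by
          rw [div_le_iff₀ ht0]
          nlinarith
        have h7 : E ≤ 2 ^ b := by
          calc E ≤ t ^ (-b) := powInterp_le_right hR ht0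
            _ ≤ (1 / 2) ^ (-b) := Real.rpow_le_rpow_of_nonpos (by norm_num) h3 (by linarith)
            _ = 2 ^ b := by
              rw [one_div, Real.inv_rpow (by norm_num), Real.rpow_neg (by norm_num), inv_inv]
        gcongr
      have h8 : ((8 * c + b / t) * E) ^ 2 ≤ ((8 * c + 2 * b) * 2 ^ b) ^ 2 :=
        pow_le_pow_left₀ (by positivity) h5 2
      linarith

theorem tendsto_setIntegral_Ioc_zero {e : ℝ → ℝ} (he : IntegrableOn e (Ioo 0 1)) :
    Filter.Tendsto (fun δ => ∫ t in Ioc 0 δ, e t) (nhdsWithin 0 (Ioi 0)) (nhds 0) := by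
  have h1 : IntervalIntegrable e volume 0 1 :=
    (intervalIntegrable_iff_integrableOn_Ioo_of_le (by norm_num)).2 he
  have h2 := intervalIntegral.continuousOn_primitive_interval' h1 left_mem_uIcc
  rw [uIcc_of_le zero_le_one] at h2
  have h3 := (h2 0 ⟨le_rfl, zero_le_one⟩).tendsto
  simp only [intervalIntegral.integral_same] at h3
  have h4 := h3.mono_left (nhdsWithin_mono (0 : ℝ) (Ioo_subset_Icc_self (a := (0 : ℝ)) (b := 1)))
  rw [nhdsWithin_Ioo_eq_nhdsGT zero_lt_one] at h4
  refine h4.congr' ?_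
  filter_upwards [self_mem_nhdsWithin] with δ hδ
  rw [intervalIntegral.integral_of_le (le_of_lt hδ)]

theorem growthSq_eq (N : ℕ) (α : ℝ) :
    growthSq N α = (α + 2) * (α + 2 * (N : ℝ) - 2) / 4 := by
  rw [growthSq]
  ring

/-- The difference is `(N - 2)(1 + α / 2)`. This provides `k ≤ b` for the exponents of the test
function. -/
theorem sq_le_growthSq (hN : 2 ≤ N) (hα : -2 < α) : (1 + α / 2) ^ 2 ≤ growthSq N α := by
  have : (2 : ℝ) ≤ N := by exact_mod_cast hN
  rw [growthSq]
  nlinarith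

/-- Decay of the energy of a stable radial solution near the origin. -/
theorem exists_energy_decay (hN : 2 ≤ N) (hα : -2 < α) :
    ∃ C, 0 < C ∧ ∀ f w p : ℝ → ℝ, ContDiff ℝ 1 f → IsRadialSolution N α f w p →
      (∀ ψ : ℝ → ℝ, ContDiff ℝ 1 ψ → tsupport ψ ⊆ Ioo 0 1 →
        0 ≤ ∫ r in Ioo 0 1, r ^ (N - 1) * (deriv ψ r ^ 2 - r ^ α * deriv f (w r) * ψ r ^ 2)) →
      ∀ R : ℝ, 0 < R → R ≤ 1 / 2 →
        ∫ r in Ioo (R / 2) R, r ^ (N - 1) * p r ^ 2 ≤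
          C * R ^ (2 * √(growthSq N α) + 2 + α) *
            ∫ r in Ioo (1 / 2) 1, r ^ (N - 1) * p r ^ 2 := by
  -- With this `k` the inner error `t ^ (2k - 2) = t ^ α` cancels the weight `t ^ (-α)` in `q²`, so
  -- that it is controlled by the energy `∫ r ^ (N - 1) w'²` alone.
  set k := 1 + α / 2 with hkdef
  set b := √(growthSq N α) with hbdef
  have hk : 0 < k := by linarith
  have hkb : k ≤ b := Real.le_sqrt_of_sq_le (sq_le_growthSq hN hα)
  have hb2 : b ^ 2 = growthSq N α :=
    Real.sq_sqrt ((sq_nonneg _).trans (sq_le_growthSq hN hα))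
  obtain ⟨c₀, C₁, hc₀, hC₁, hform⟩ := exists_quadratic_form_bounds hk hkb
  refine ⟨2 ^ |α| * C₁ * 2 ^ |α| / c₀, by positivity, fun f w p hf h hst R hR hR2 => ?_⟩
  obtain ⟨C₂, hC₂, hform⟩ := hform R hR hR2
  set e : ℝ → ℝ := fun t => t ^ (N - 1) * p t ^ 2 with he
  have hei : IntegrableOn e (Ioo 0 1) := h.integrableOn
  have he0 : ∀ t ∈ Ioo (0 : ℝ) 1, 0 ≤ e t := fun t ht => by
    have := ht.1
    positivity
  have hw : ∀ t ∈ Ioo (0 : ℝ) 1,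
      t ^ (N - 1) * (p t / t ^ (α / 2)) ^ 2 = e t * t ^ (-α) := fun t ht => by
    have := ht.1
    rw [Real.rpow_neg ht.1.le, rpow_eq_sq_half (α := α) ht.1, div_pow, he]
    field_simp
  have hsubR : Ioo (R / 2) R ⊆ Ioo 0 1 := Ioo_subset_Ioo (by linarith) (by linarith)
  have hsubA : Ico (1 / 2 : ℝ) 1 ⊆ Ioo 0 1 := fun t ht => ⟨by linarith [ht.1], ht.2⟩
  set d := c₀ * R ^ (-(2 * b + 2)) * (2 ^ |α|)⁻¹ * R ^ (-α) with hd
  have key : ∀ ε : ℝ, 0 < ε → 4 * ε ≤ R → d * ∫ t in Ioo (R / 2) R, e t ≤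
      C₁ * 2 ^ |α| * (∫ t in Ioo (1 / 2) 1, e t) + C₂ * ∫ t in Ioc 0 (2 * ε), e t := by
    intro ε hε hεR
    have hsubE : Ioc 0 (2 * ε) ⊆ Ioo 0 1 := fun t ht => ⟨ht.1, by linarith [ht.2]⟩
    have hηs : tsupport (fun t => cutoff ε t * powInterp k b R t) ⊆ Ioo 0 1 :=
      tsupport_mul_subset_Ioo (tsupport_cutoff_subset_Ioo hε)
    have hηd : ContDiff ℝ 1 (fun t => cutoff ε t * powInterp k b R t) :=
      contDiff_mul_of_contDiffOn (n := 1) contDiff_cutoff (tsupport_cutoff_subset_Ioo hε)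
        (contDiffOn_powInterp hR)
    have hκc : HasCompactSupport (cutoff ε) :=
      HasCompactSupport.of_support_subset_isCompact isCompact_Icc
        ((subset_tsupport _).trans (tsupport_cutoff_subset hε))
    have h1 := h.integral_nonneg_of_stable hf hst (by omega) hηd hκc.mul_right hηs
    set g₁ : ℝ → ℝ := (Ioo (R / 2) R).indicator (fun t => -(d * e t)) with hg₁
    set g₂ : ℝ → ℝ := (Ico (1 / 2) 1).indicator (fun t => C₁ * 2 ^ |α| * e t) with hg₂
    set g₃ : ℝ → ℝ := (Ioc 0 (2 * ε)).indicator (fun t => C₂ * e t) with hg₃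
    have hi₁ : Integrable g₁ := (integrable_indicator_iff measurableSet_Ioo).2
      ((hei.mono_set hsubR).const_mul d).neg
    have hi₂ : Integrable g₂ := (integrable_indicator_iff measurableSet_Ico).2
      ((hei.mono_set hsubA).const_mul _)
    have hi₃ : Integrable g₃ := (integrable_indicator_iff measurableSet_Ioc).2
      ((hei.mono_set hsubE).const_mul _)
    have h2 : ∫ t in Ioo 0 1, t ^ (N - 1) * (p t / t ^ (α / 2)) ^ 2 *
        (deriv (fun t => cutoff ε t * powInterp k b R t) t ^ 2
          - growthSq N α * (cutoff ε t * powInterp k b R t) ^ 2 / t ^ 2) ≤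
        ∫ t in Ioo 0 1, (g₁ t + (g₂ t + g₃ t)) := by
      refine setIntegral_mono_on h1.1 (hi₁.add (hi₂.add hi₃)).integrableOn measurableSet_Ioo
        fun t ht => ?_
      have h3 := hform ε hε hεR t ht
      have ht0 := ht.1
      have het := he0 t ht
      have hW : 0 ≤ e t * t ^ (-α) := by positivity
      rw [hw t ht, ← hb2]
      refine (mul_le_mul_of_nonneg_left h3 hW).trans ?_
      rw [mul_add, mul_add]
      refine add_le_add ?_ (add_le_add ?_ ?_)
      · by_cases hm : t ∈ Ioo (R / 2) R
        · rw [indicator_of_mem hm, hg₁, indicator_of_mem hm, mul_neg, neg_le_neg_iff, hd]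
          have h4 := le_rpow_of_mem_Icc_half hR ⟨hm.1.le, hm.2.le⟩ (-α)
          rw [abs_neg] at h4
          calc c₀ * R ^ (-(2 * b + 2)) * (2 ^ |α|)⁻¹ * R ^ (-α) * e t
              ≤ c₀ * R ^ (-(2 * b + 2)) * (2 ^ |α|)⁻¹ * (2 ^ |α| * t ^ (-α)) * e t := by gcongr
            _ = e t * t ^ (-α) * (c₀ * R ^ (-(2 * b + 2))) := by field_simp
        · rw [indicator_of_notMem hm, hg₁, indicator_of_notMem hm, mul_zero]
      · by_cases hm : t ∈ Ico (1 / 2 : ℝ) 1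
        · rw [indicator_of_mem hm, hg₂, indicator_of_mem hm]
          have h4 := rpow_le_of_mem_Icc_half one_pos ⟨hm.1, hm.2.le⟩ (-α)
          rw [abs_neg, Real.one_rpow, mul_one] at h4
          calc e t * t ^ (-α) * C₁ ≤ e t * 2 ^ |α| * C₁ := by gcongr
            _ = C₁ * 2 ^ |α| * e t := by ring
        · rw [indicator_of_notMem hm, hg₂, indicator_of_notMem hm, mul_zero]
      · by_cases hm : t ∈ Ioc 0 (2 * ε)
        · rw [indicator_of_mem hm, hg₃, indicator_of_mem hm]
          have h4 : t ^ (-α) * t ^ (2 * k - 2) = 1 := by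
            rw [← Real.rpow_add ht0, hkdef]
            ring_nf
            exact Real.rpow_zero t
          calc e t * t ^ (-α) * (C₂ * t ^ (2 * k - 2))
              = C₂ * e t * (t ^ (-α) * t ^ (2 * k - 2)) := by ring
            _ ≤ C₂ * e t := by rw [h4, mul_one]
        · rw [indicator_of_notMem hm, hg₃, indicator_of_notMem hm, mul_zero]
    have h3 := h1.2.trans h2
    have hi₂₃ : Integrable (fun t => g₂ t + g₃ t) := hi₂.add hi₃
    rw [integral_add hi₁.integrableOn hi₂₃.integrableOn,
      integral_add hi₂.integrableOn hi₃.integrableOn, hg₁, hg₂, hg₃,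
      setIntegral_indicator measurableSet_Ioo, setIntegral_indicator measurableSet_Ico,
      setIntegral_indicator measurableSet_Ioc, inter_eq_right.2 hsubR, inter_eq_right.2 hsubA,
      inter_eq_right.2 hsubE, integral_neg, integral_const_mul, integral_const_mul,
      integral_const_mul, integral_Ico_eq_integral_Ioo] at h3
    linarith
  -- Letting `ε → 0` removes the inner error, since the energy is integrable up to the origin.
  have hlim : d * ∫ t in Ioo (R / 2) R, e t ≤ C₁ * 2 ^ |α| * (∫ t in Ioo (1 / 2) 1, e t) := by
    have h1 := ((tendsto_setIntegral_Ioc_zero hei).const_mul C₂).const_add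
      (C₁ * 2 ^ |α| * ∫ t in Ioo (1 / 2) 1, e t)
    rw [mul_zero, add_zero] at h1
    refine ge_of_tendsto h1 ?_
    filter_upwards [Ioo_mem_nhdsGT (show (0 : ℝ) < R / 2 by positivity)] with δ hδ
    have := key (δ / 2) (by linarith [hδ.1]) (by linarith [hδ.2])
    rwa [mul_div_cancel₀ _ (two_ne_zero)] at this
  have hd0 : 0 < d := by positivity
  have hdinv : d * (2 ^ |α| / c₀ * R ^ (2 * b + 2 + α)) = 1 := by
    have e1 : R ^ (2 * b + 2 + α) = R ^ (2 * b + 2) * R ^ α := Real.rpow_add hR _ _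
    rw [hd, e1, Real.rpow_neg hR.le, Real.rpow_neg hR.le]
    field_simp
  calc ∫ t in Ioo (R / 2) R, e t
      = 2 ^ |α| / c₀ * R ^ (2 * b + 2 + α) * (d * ∫ t in Ioo (R / 2) R, e t) := by
        rw [← mul_assoc, mul_comm _ d, hdinv, one_mul]
    _ ≤ 2 ^ |α| / c₀ * R ^ (2 * b + 2 + α) *
        (C₁ * 2 ^ |α| * (∫ t in Ioo (1 / 2) 1, e t)) := by gcongr
    _ = _ := by ring

end Energy

/-! ### Oscillation of the profile on dyadic intervals. -/

section Oscillation

variable {N : ℕ} {α : ℝ} {f w p : ℝ → ℝ}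

/-- Cauchy-Schwarz, obtained by expanding `∫ (p - m)² ≥ 0` with `m` the mean of `p`. -/
theorem IsRadialSolution.sq_sub_le (h : IsRadialSolution N α f w p) {s t : ℝ} (hs : 0 < s)
    (hst : s ≤ t) (ht : t < 1) : (w t - w s) ^ 2 ≤ (t - s) * ∫ r in Ioo s t, p r ^ 2 := by
  rcases hst.eq_or_lt with rfl | hlt
  · simp
  have hsub : uIcc s t ⊆ Ioo 0 1 :=
    OrdConnected.uIcc_subset ordConnected_Ioo ⟨hs, by linarith⟩ ⟨by linarith, ht⟩
  have hpc : ContinuousOn p (uIcc s t) := h.continuousOn_deriv.mono hsub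
  have hpi : IntervalIntegrable p volume s t := hpc.intervalIntegrable
  have hp2 : IntervalIntegrable (fun r => p r ^ 2) volume s t := (hpc.pow 2).intervalIntegrable
  have h1 : ∫ r in s..t, p r = w t - w s :=
    intervalIntegral.integral_eq_sub_of_hasDerivAt (fun r hr => h.hasDerivAt r (hsub hr)) hpi
  rw [← integral_Ioc_eq_integral_Ioo, ← intervalIntegral.integral_of_le hst, ← h1]
  set I := ∫ r in s..t, p r
  set m := I / (t - s) with hm
  have hts : 0 < t - s := by linarith
  have h2 : 0 ≤ ∫ r in s..t, (p r - m) ^ 2 :=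
    intervalIntegral.integral_nonneg hst fun r _ => sq_nonneg _
  have h3 : ∫ r in s..t, (p r - m) ^ 2 =
      (∫ r in s..t, p r ^ 2) - 2 * m * I + (t - s) * m ^ 2 := by
    have e : ∀ r, (p r - m) ^ 2 = (p r ^ 2 - 2 * m * p r) + m ^ 2 := fun r => by ring
    simp only [e]
    rw [intervalIntegral.integral_add (hp2.sub (hpi.const_mul _)) (by simp),
      intervalIntegral.integral_sub hp2 (hpi.const_mul _), intervalIntegral.integral_const_mul,
      intervalIntegral.integral_const, smul_eq_mul]
  have h4 : m * (t - s) = I := div_mul_cancel₀ _ hts.ne'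
  rw [h3] at h2
  nlinarith

theorem IsRadialSolution.integral_sq_le (h : IsRadialSolution N α f w p) {a s t : ℝ}
    (ha : 0 < a) (has : a ≤ s) (ht : t ≤ 1) :
    a ^ (N - 1) * ∫ r in Ioo s t, p r ^ 2 ≤ ∫ r in Ioo s t, r ^ (N - 1) * p r ^ 2 := by
  rw [← integral_const_mul]
  have hsub : Ioo s t ⊆ Ioo 0 1 := Ioo_subset_Ioo (by linarith) ht
  refine integral_mono_of_nonneg ?_ (h.integrableOn.mono_set hsub) ?_
  · exact Filter.Eventually.of_forall fun r => by positivity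
  · filter_upwards [ae_restrict_mem measurableSet_Ioo] with r hr
    have : a ≤ r := has.trans hr.1.le
    gcongr

theorem IsRadialSolution.setIntegral_mono (h : IsRadialSolution N α f w p) {s t s' t' : ℝ}
    (hs : s' ≤ s) (ht : t ≤ t') (hs0 : 0 ≤ s') (ht1 : t' ≤ 1) :
    ∫ r in Ioo s t, r ^ (N - 1) * p r ^ 2 ≤ ∫ r in Ioo s' t', r ^ (N - 1) * p r ^ 2 := by
  refine setIntegral_mono_set (h.integrableOn.mono_set (Ioo_subset_Ioo hs0 ht1)) ?_
    (Ioo_subset_Ioo hs ht).eventuallyLE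
  filter_upwards [ae_restrict_mem measurableSet_Ioo] with r hr
  have : 0 ≤ r := hs0.trans hr.1.le
  exact mul_nonneg (pow_nonneg this _) (sq_nonneg _)

/-- The one-dimensional Sobolev inequality on the interval `(1 / 2, 1)`. -/
theorem IsRadialSolution.sq_le (h : IsRadialSolution N α f w p) {t : ℝ}
    (ht : t ∈ Icc (1 / 2 : ℝ) 1) :
    w t ^ 2 ≤ 4 * 2 ^ (N - 1) * ((∫ r in Ioo (1 / 2) 1, r ^ (N - 1) * w r ^ 2) +
      ∫ r in Ioo (1 / 2) 1, r ^ (N - 1) * p r ^ 2) := by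
  set A := ∫ r in Ioo (1 / 2) 1, r ^ (N - 1) * p r ^ 2
  set B := ∫ r in Ioo (1 / 2) 1, r ^ (N - 1) * w r ^ 2
  have hwc : ContinuousOn w (Icc (1 / 2) 1) := h.continuousOn.mono fun r hr =>
    ⟨by linarith [hr.1], hr.2⟩
  suffices hopen : ∀ t ∈ Ioo (1 / 2 : ℝ) 1, w t ^ 2 ≤ 4 * 2 ^ (N - 1) * (B + A) by
    have h1 : ContinuousOn (fun t => w t ^ 2) (closure (Ioo (1 / 2 : ℝ) 1)) := by
      rw [closure_Ioo (by norm_num)]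
      exact hwc.pow 2
    refine le_on_closure (f := fun t => w t ^ 2) (g := fun _ => 4 * 2 ^ (N - 1) * (B + A)) hopen h1
      continuousOn_const ?_
    rwa [closure_Ioo (by norm_num)]
  intro t ht
  have hpow : (1 / 2 : ℝ) ^ (N - 1) * 2 ^ (N - 1) = 1 := by
    rw [← mul_pow]
    norm_num
  have hosc : ∀ s t : ℝ, 1 / 2 < s → s ≤ t → t < 1 → (w t - w s) ^ 2 ≤ 2 ^ (N - 1) * A := by
    intro s t hs hst ht
    have h1 := h.sq_sub_le (by linarith) hst ht
    have h2 := h.integral_sq_le (a := 1 / 2) (by norm_num) hs.le ht.le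
    have h3 := h.setIntegral_mono hs.le ht.le (by norm_num) le_rfl
    have h4 : 0 ≤ ∫ r in Ioo s t, p r ^ 2 := integral_nonneg fun _ => sq_nonneg _
    calc (w t - w s) ^ 2 ≤ (t - s) * ∫ r in Ioo s t, p r ^ 2 := h1
      _ ≤ 1 * ∫ r in Ioo s t, p r ^ 2 := by gcongr; linarith
      _ = 2 ^ (N - 1) * ((1 / 2) ^ (N - 1) * ∫ r in Ioo s t, p r ^ 2) := by
        rw [← mul_assoc, mul_comm (2 ^ (N - 1) : ℝ), hpow]
      _ ≤ 2 ^ (N - 1) * A := by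
        gcongr
        exact h2.trans h3
  -- Averaging this over `s` in `(1/2, 1)` replaces the pointwise value by the `L²` norm.
  have hosc' : ∀ s ∈ Ioo (1 / 2 : ℝ) 1, w t ^ 2 ≤ 2 * w s ^ 2 + 2 * (2 ^ (N - 1) * A) := by
    intro s hs
    have : (w t - w s) ^ 2 ≤ 2 ^ (N - 1) * A := by
      rcases le_total s t with hst | hst
      · exact hosc s t hs.1 hst ht.2
      · rw [← neg_sq, neg_sub]
        exact hosc t s ht.1 hst hs.2
    nlinarith [sq_nonneg (w t - 2 * w s)]
  have hwi : IntegrableOn (fun r => w r ^ 2) (Ioo (1 / 2) 1) :=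
    ((hwc.pow 2).integrableOn_compact isCompact_Icc).mono_set Ioo_subset_Icc_self
  have hwi' : IntegrableOn (fun r => r ^ (N - 1) * w r ^ 2) (Ioo (1 / 2) 1) :=
    (((continuousOn_pow _).mul (hwc.pow 2)).integrableOn_compact isCompact_Icc).mono_set
      Ioo_subset_Icc_self
  have h1 : ∫ _ in Ioo (1 / 2 : ℝ) 1, w t ^ 2 ≤
      ∫ s in Ioo (1 / 2 : ℝ) 1, (2 * w s ^ 2 + 2 * (2 ^ (N - 1) * A)) :=
    setIntegral_mono_on (by simp) ((hwi.const_mul 2).add (integrable_const _)) measurableSet_Ioo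
      hosc'
  rw [integral_add (hwi.const_mul 2) (integrable_const _), integral_const_mul] at h1
  simp only [setIntegral_const, Real.volume_real_Ioo, smul_eq_mul] at h1
  have h2 : (1 / 2) ^ (N - 1) * ∫ s in Ioo (1 / 2 : ℝ) 1, w s ^ 2 ≤ B := by
    rw [← integral_const_mul]
    refine setIntegral_mono_on (hwi.const_mul _) hwi' measurableSet_Ioo fun r hr => ?_
    have := hr.1
    gcongr
  have h3 : ∫ s in Ioo (1 / 2 : ℝ) 1, w s ^ 2 ≤ 2 ^ (N - 1) * B := by
    calc ∫ s in Ioo (1 / 2 : ℝ) 1, w s ^ 2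
        = 2 ^ (N - 1) * ((1 / 2) ^ (N - 1) * ∫ s in Ioo (1 / 2 : ℝ) 1, w s ^ 2) := by
          rw [← mul_assoc, mul_comm (2 ^ (N - 1) : ℝ), hpow, one_mul]
      _ ≤ 2 ^ (N - 1) * B := by gcongr
  norm_num at h1
  have hA : 0 ≤ A := setIntegral_nonneg measurableSet_Ioo fun r hr => by
    have : 0 < r := by linarith [hr.1]
    positivity
  have : 0 ≤ 2 ^ (N - 1) * A := by positivity
  linarith

theorem gammaExp_eq (N : ℕ) (α : ℝ) :
    gammaExp N α = 2 - (N : ℝ) / 2 + α / 2 + √(growthSq N α) := by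
  rw [gammaExp, growthSq_eq, Real.sqrt_div' _ (by norm_num),
    show (4 : ℝ) = 2 ^ 2 by norm_num, Real.sqrt_sq (by norm_num)]

/-- On `[s, R]`, Cauchy-Schwarz contributes a factor `R`, removing the weight `r ^ (N - 1)` costs `R
^ (1 - N)`, and the energy decays like `R ^ (2b + 2 + α)` with `b = √(growthSq N α)`. The exponents
add up to `4 - N + α + 2b = 2γ`. -/
theorem exists_oscillation_bound (hN : 2 ≤ N) (hα : -2 < α) :
    ∃ C, 0 < C ∧ ∀ f w p : ℝ → ℝ, ContDiff ℝ 1 f → IsRadialSolution N α f w p →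
      (∀ ψ : ℝ → ℝ, ContDiff ℝ 1 ψ → tsupport ψ ⊆ Ioo 0 1 →
        0 ≤ ∫ r in Ioo 0 1, r ^ (N - 1) * (deriv ψ r ^ 2 - r ^ α * deriv f (w r) * ψ r ^ 2)) →
      ∀ M : ℝ, 0 ≤ M → (∫ r in Ioo (1 / 2) 1, r ^ (N - 1) * w r ^ 2) +
        (∫ r in Ioo (1 / 2) 1, r ^ (N - 1) * p r ^ 2) ≤ M ^ 2 →
      (∀ r ∈ Icc (1 / 2 : ℝ) 1, |w r| ≤ C * M) ∧
      ∀ R s : ℝ, 0 < R → R ≤ 1 / 2 → s ∈ Icc (R / 2) R →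
        |w R - w s| ≤ C * M * R ^ gammaExp N α := by
  obtain ⟨C, hC, hdec⟩ := exists_energy_decay hN hα
  -- The first summand serves the Sobolev bound on `[1/2, 1]`, the second the oscillation bound.
  refine ⟨√(4 * 2 ^ (N - 1)) + √(2 ^ (N - 1) * C), by positivity,
    fun f w p hf h hst M hM hAB => ⟨fun r hr => ?_, fun R s hR hR2 hs => ?_⟩⟩
  · have h1 : w r ^ 2 ≤ (√(4 * 2 ^ (N - 1)) * M) ^ 2 := by
      rw [mul_pow, Real.sq_sqrt (by positivity)]
      refine (h.sq_le hr).trans ?_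
      gcongr
    have h2 := abs_le_of_sq_le_sq h1 (by positivity)
    have : 0 ≤ √(2 ^ (N - 1) * C) * M := by positivity
    exact h2.trans (by rw [add_mul]; linarith)
  · have hA : ∫ r in Ioo (1 / 2) 1, r ^ (N - 1) * p r ^ 2 ≤ M ^ 2 := by
      have : 0 ≤ ∫ r in Ioo (1 / 2) 1, r ^ (N - 1) * w r ^ 2 :=
        setIntegral_nonneg measurableSet_Ioo fun r hr => by
          have : 0 < r := by linarith [hr.1]
          positivity
      linarith
    have hs0 : 0 < s := by linarith [hs.1]
    have h1 := h.sq_sub_le hs0 hs.2 (by linarith)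
    have h2 := h.integral_sq_le (a := R / 2) (t := R) (by linarith) hs.1 (by linarith)
    have h3 := h.setIntegral_mono (s := s) (t := R) hs.1 le_rfl (by linarith) (by linarith)
    have h4 := hdec f w p hf h hst R hR hR2
    have h5 : 0 ≤ ∫ r in Ioo s R, p r ^ 2 := integral_nonneg fun _ => sq_nonneg _
    have e : R * (2 ^ (N - 1) / R ^ (N - 1) * R ^ (2 * √(growthSq N α) + 2 + α)) =
        2 ^ (N - 1) * (R ^ gammaExp N α) ^ 2 := by
      have e1 : (R ^ gammaExp N α) ^ 2 =
          R * (R ^ (2 * √(growthSq N α) + 2 + α) / R ^ (N - 1)) := by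
        rw [← Real.rpow_natCast R (N - 1), ← Real.rpow_sub hR]
        nth_rewrite 2 [← Real.rpow_one R]
        rw [← Real.rpow_add hR, ← Real.rpow_natCast (R ^ gammaExp N α), ← Real.rpow_mul hR.le,
          gammaExp_eq, Nat.cast_sub (by omega)]
        congr 1
        push_cast
        ring
      rw [e1]
      ring
    have h6 : (w R - w s) ^ 2 ≤ (√(2 ^ (N - 1) * C) * M * R ^ gammaExp N α) ^ 2 := by
      calc (w R - w s) ^ 2 ≤ (R - s) * ∫ r in Ioo s R, p r ^ 2 := h1
        _ ≤ R * ∫ r in Ioo s R, p r ^ 2 := by gcongr; linarith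
        _ = R * (2 ^ (N - 1) / R ^ (N - 1) *
            ((R / 2) ^ (N - 1) * ∫ r in Ioo s R, p r ^ 2)) := by
          rw [div_pow]
          field_simp
        _ ≤ R * (2 ^ (N - 1) / R ^ (N - 1) *
            (C * R ^ (2 * √(growthSq N α) + 2 + α) * M ^ 2)) := by
          refine mul_le_mul_of_nonneg_left (mul_le_mul_of_nonneg_left
            ((h2.trans h3).trans (h4.trans ?_)) (by positivity)) hR.le
          gcongr
        _ = C * M ^ 2 * (R * (2 ^ (N - 1) / R ^ (N - 1) *
            R ^ (2 * √(growthSq N α) + 2 + α))) := by ring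
        _ = (√(2 ^ (N - 1) * C) * M * R ^ gammaExp N α) ^ 2 := by
          rw [e, mul_pow, mul_pow, Real.sq_sqrt (by positivity)]
          ring
    have h7 := abs_le_of_sq_le_sq h6 (by positivity)
    have : 0 ≤ √(4 * 2 ^ (N - 1)) * M * R ^ gammaExp N α := by positivity
    exact h7.trans (by rw [add_mul, add_mul]; linarith)

end Oscillation

/-! ### Summation over dyadic scales. -/

section Dyadic

variable {w : ℝ → ℝ} {K γ : ℝ}

/-- Comparison with a barrier `Ψ`: going from `2r` down to `r` changes `w` by at most `K (2r) ^ γ`,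
and `Ψ` grows by at least `(2r) ^ γ`. The threshold is `1 / 4` because the oscillation bound at `R =
2r` needs `2r ≤ 1 / 2`. -/
theorem abs_le_mul_of_dyadic (h1 : ∀ r ∈ Icc (1 / 2 : ℝ) 1, |w r| ≤ K)
    (h2 : ∀ R s : ℝ, 0 < R → R ≤ 1 / 2 → s ∈ Icc (R / 2) R → |w R - w s| ≤ K * R ^ γ)
    {Ψ : ℝ → ℝ} (hΨ1 : ∀ r ∈ Icc (1 / 4 : ℝ) 1, 1 + (1 / 2) ^ γ ≤ Ψ r)
    (hΨ2 : ∀ r : ℝ, 0 < r → r ≤ 1 / 4 → Ψ (2 * r) + (2 * r) ^ γ ≤ Ψ r) {r : ℝ}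
    (hr : r ∈ Ioc (0 : ℝ) 1) : |w r| ≤ K * Ψ r := by
  have hK : 0 ≤ K := (abs_nonneg _).trans (h1 1 ⟨by norm_num, le_rfl⟩)
  have hbase : ∀ r ∈ Icc (1 / 4 : ℝ) 1, |w r| ≤ K * Ψ r := by
    intro r hr
    refine le_trans ?_ (mul_le_mul_of_nonneg_left (hΨ1 r hr) hK)
    have hpos : 0 ≤ K * (1 / 2 : ℝ) ^ γ := by positivity
    rcases le_total (1 / 2) r with h | h
    · linarith [h1 r ⟨h, hr.2⟩]
    · have h3 := h2 (1 / 2) r (by norm_num) le_rfl ⟨by linarith [hr.1], h⟩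
      have h4 := h1 (1 / 2) ⟨le_rfl, by norm_num⟩
      have h5 := abs_sub_abs_le_abs_sub (w r) (w (1 / 2))
      rw [abs_sub_comm] at h5
      linarith
  have hind : ∀ n : ℕ, ∀ r : ℝ, (1 / 2) ^ n * (1 / 4) ≤ r → r ≤ 1 → |w r| ≤ K * Ψ r := by
    intro n
    induction n with
    | zero => exact fun r h h' => hbase r ⟨by simpa using h, h'⟩
    | succ n ih =>
      intro r h h'
      rcases le_or_gt (1 / 4) r with h3 | h3
      · exact hbase r ⟨h3, h'⟩
      · have hr0 : 0 < r := lt_of_lt_of_le (by positivity) h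
        have h4 := ih (2 * r) (by rw [pow_succ] at h; linarith) (by linarith)
        have h5 := h2 (2 * r) r (by linarith) (by linarith) ⟨by linarith, by linarith⟩
        have h6 := abs_sub_abs_le_abs_sub (w r) (w (2 * r))
        rw [abs_sub_comm] at h6
        have h7 := mul_le_mul_of_nonneg_left (hΨ2 r hr0 h3.le) hK
        linarith
  obtain ⟨n, hn⟩ := exists_pow_lt_of_lt_one hr.1 (by norm_num : (1 / 2 : ℝ) < 1)
  have : (0 : ℝ) < (1 / 2) ^ n := by positivity
  exact hind n r (by linarith) hr.2

theorem exists_dyadic_bound_of_pos (hγ : 0 < γ) :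
    ∃ C, 0 < C ∧ ∀ (w : ℝ → ℝ) (K : ℝ), (∀ r ∈ Icc (1 / 2 : ℝ) 1, |w r| ≤ K) →
      (∀ R s : ℝ, 0 < R → R ≤ 1 / 2 → s ∈ Icc (R / 2) R → |w R - w s| ≤ K * R ^ γ) →
      ∀ r ∈ Ioc (0 : ℝ) 1, |w r| ≤ K * C := by
  have h2 : (1 : ℝ) < 2 ^ γ := Real.one_lt_rpow (by norm_num) hγ
  have h3 : (0 : ℝ) < 2 ^ γ - 1 := by linarith
  set B : ℝ := 2 ^ γ / (2 ^ γ - 1) with hB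
  have hB0 : 0 < B := by positivity
  refine ⟨B + 2, by linarith, fun w K hw1 hw2 r hr => ?_⟩
  have hK : 0 ≤ K := (abs_nonneg _).trans (hw1 1 ⟨by norm_num, le_rfl⟩)
  -- The barrier is bounded since `γ > 0`, and `B (2 ^ γ - 1) = 2 ^ γ` makes the doubling condition
  -- an equality.
  have h := abs_le_mul_of_dyadic hw1 hw2 (Ψ := fun r => B + 2 - B * r ^ γ) ?_ ?_ hr
  · refine h.trans (mul_le_mul_of_nonneg_left ?_ hK)
    have := hr.1
    have : 0 ≤ B * r ^ γ := by positivity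
    linarith
  · intro r hr
    have h4 : r ^ γ ≤ 1 := Real.rpow_le_one (by linarith [hr.1]) hr.2 hγ.le
    have h5 : (1 / 2 : ℝ) ^ γ ≤ 1 := Real.rpow_le_one (by norm_num) (by norm_num) hγ.le
    nlinarith
  · intro r hr _
    rw [Real.mul_rpow (by norm_num) hr.le]
    have : B * (2 ^ γ - 1) = 2 ^ γ := div_mul_cancel₀ _ h3.ne'
    have h4 : B * 2 ^ γ * r ^ γ = (2 ^ γ + B) * r ^ γ := by
      congr 1
      linarith
    nlinarith

theorem exists_dyadic_bound_of_eq_zero :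
    ∃ C, 0 < C ∧ ∀ (w : ℝ → ℝ) (K : ℝ), (∀ r ∈ Icc (1 / 2 : ℝ) 1, |w r| ≤ K) →
      (∀ R s : ℝ, 0 < R → R ≤ 1 / 2 → s ∈ Icc (R / 2) R → |w R - w s| ≤ K * R ^ (0 : ℝ)) →
      ∀ r ∈ Ioc (0 : ℝ) 1, |w r| ≤ K * (C * (|Real.log r| + 1)) := by
  have hl : 0 < Real.log 2 := Real.log_pos (by norm_num)
  refine ⟨(Real.log 2)⁻¹ + 2, by positivity, fun w K hw1 hw2 r hr => ?_⟩
  have hK : 0 ≤ K := (abs_nonneg _).trans (hw1 1 ⟨by norm_num, le_rfl⟩)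
  -- For `γ = 0` each scale contributes the same amount, and `-log r / log 2` counts the scales.
  have h := abs_le_mul_of_dyadic hw1 hw2 (Ψ := fun r => 2 - (Real.log 2)⁻¹ * Real.log r) ?_ ?_ hr
  · refine h.trans (mul_le_mul_of_nonneg_left ?_ hK)
    have h3 : -Real.log r ≤ |Real.log r| := neg_le_abs _
    have h4 : 0 ≤ |Real.log r| := abs_nonneg _
    have h5 : 0 < (Real.log 2)⁻¹ := by positivity
    nlinarith
  · intro r hr
    have h3 : Real.log r ≤ 0 := Real.log_nonpos (by linarith [hr.1]) hr.2
    have h5 : 0 < (Real.log 2)⁻¹ := by positivity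
    rw [Real.rpow_zero]
    nlinarith
  · intro r hr _
    rw [Real.rpow_zero, Real.log_mul (by norm_num) hr.ne', mul_add, inv_mul_cancel₀ hl.ne']
    linarith

theorem exists_dyadic_bound_of_neg (hγ : γ < 0) :
    ∃ C, 0 < C ∧ ∀ (w : ℝ → ℝ) (K : ℝ), (∀ r ∈ Icc (1 / 2 : ℝ) 1, |w r| ≤ K) →
      (∀ R s : ℝ, 0 < R → R ≤ 1 / 2 → s ∈ Icc (R / 2) R → |w R - w s| ≤ K * R ^ γ) →
      ∀ r ∈ Ioc (0 : ℝ) 1, |w r| ≤ K * (C * r ^ γ) := by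
  have h2 : (2 : ℝ) ^ γ < 1 := Real.rpow_lt_one_of_one_lt_of_neg (by norm_num) hγ
  have h3 : (0 : ℝ) < 1 - 2 ^ γ := by linarith
  set B : ℝ := 2 ^ γ / (1 - 2 ^ γ) with hB
  have hB0 : 0 < B := by positivity
  refine ⟨1 + (1 / 2) ^ γ + B, by positivity, fun w K hw1 hw2 r hr => ?_⟩
  -- For `γ < 0` the sum is dominated by its last term. Here `B (1 - 2 ^ γ) = 2 ^ γ` absorbs the
  -- increment, and the remaining summands of the coefficient cover the range `[1/4, 1]`.
  refine abs_le_mul_of_dyadic hw1 hw2 (Ψ := fun r => (1 + (1 / 2) ^ γ + B) * r ^ γ) ?_ ?_ hr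
  · intro r hr
    have h4 : 1 ≤ r ^ γ :=
      Real.one_le_rpow_of_pos_of_le_one_of_nonpos (by linarith [hr.1]) hr.2 hγ.le
    have h5 : (0 : ℝ) < (1 / 2) ^ γ := by positivity
    nlinarith
  · intro r hr _
    have hr' : 0 < r ^ γ := by positivity
    rw [Real.mul_rpow (by norm_num) hr.le]
    have h4 : B * (1 - 2 ^ γ) = 2 ^ γ := div_mul_cancel₀ _ h3.ne'
    have h5 : (0 : ℝ) < 1 + (1 / 2) ^ γ := by positivity
    have h6 : (1 + (1 / 2) ^ γ + B) * 2 ^ γ + 2 ^ γ ≤ 1 + (1 / 2) ^ γ + B := by nlinarith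
    calc (1 + (1 / 2) ^ γ + B) * (2 ^ γ * r ^ γ) + 2 ^ γ * r ^ γ
        = ((1 + (1 / 2) ^ γ + B) * 2 ^ γ + 2 ^ γ) * r ^ γ := by ring
      _ ≤ (1 + (1 / 2) ^ γ + B) * r ^ γ := by gcongr

end Dyadic

/-! ### The sign of the exponent. -/

section Sign

variable {N : ℕ} {α : ℝ}

/-- Everything rests on `(α + 2)(α + 2N - 2) - (N - 4 - α)² = (N - 2)(4(α + 2) - (N - 2))`, whose
last factor is `10 + 4α - N`. -/
theorem gammaExp_pos (hN : 2 ≤ N) (hα : -2 < α) (h : (N : ℝ) < 10 + 4 * α) :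
    0 < gammaExp N α := by
  have hN' : (2 : ℝ) ≤ N := by exact_mod_cast hN
  have h1 : (N : ℝ) - 4 - α < √((α + 2) * (α + 2 * (N : ℝ) - 2)) := by
    rcases lt_or_ge ((N : ℝ) - 4 - α) 0 with h2 | h2
    · exact h2.trans_le (Real.sqrt_nonneg _)
    · refine Real.lt_sqrt_of_sq_lt ?_
      have h3 : 0 < ((N : ℝ) - 2) * (4 * (α + 2) - (N - 2)) :=
        mul_pos (by linarith) (by linarith)
      nlinarith
  rw [gammaExp]
  linarith

theorem gammaExp_eq_zero (hα : -2 < α) (h : (N : ℝ) = 10 + 4 * α) : gammaExp N α = 0 := by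
  have h1 : √((α + 2) * (α + 2 * (N : ℝ) - 2)) = 3 * (α + 2) := by
    rw [show (α + 2) * (α + 2 * (N : ℝ) - 2) = (3 * (α + 2)) ^ 2 by rw [h]; ring]
    exact Real.sqrt_sq (by linarith)
  rw [gammaExp, h1, h]
  ring

theorem gammaExp_neg (hα : -2 < α) (h : 10 + 4 * α < (N : ℝ)) : gammaExp N α < 0 := by
  have h1 : √((α + 2) * (α + 2 * (N : ℝ) - 2)) < (N : ℝ) - 4 - α := by
    rw [Real.sqrt_lt' (by linarith)]
    have h3 : 0 < ((N : ℝ) - 2) * ((N - 2) - 4 * (α + 2)) :=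
      mul_pos (by linarith) (by linarith)
    nlinarith
  rw [gammaExp]
  linarith

end Sign

/-! ### Assembly of the estimates. -/

theorem nontrivial_euclideanSpace {N : ℕ} (hN : 0 < N) :
    Nontrivial (EuclideanSpace ℝ (Fin N)) :=
  Module.nontrivial_of_finrank_pos (R := ℝ) (by rwa [finrank_euclideanSpace_fin])

theorem h1Norm_nonneg {N : ℕ} (U : Set (EuclideanSpace ℝ (Fin N)))
    (u : EuclideanSpace ℝ (Fin N) → ℝ) : 0 ≤ h1Norm U u := Real.sqrt_nonneg _

/-- The radial profile of a stable radial solution, with its dyadic oscillation bounds. -/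
theorem exists_profile_bounds {N : ℕ} (hN : 2 ≤ N) {α : ℝ} (hα : -2 < α) :
    ∃ C, 0 < C ∧ ∀ (f : ℝ → ℝ) (u : EuclideanSpace ℝ (Fin N) → ℝ), ContDiff ℝ 1 f →
      MemH1 (unitBall N) u → IsRadial u → IsWeakSolution α f u → IsStable α f u →
      ∃ w : ℝ → ℝ, ContinuousOn w (Ioc 0 1) ∧
        (∀ᵐ x ∂(volume.restrict (unitBall N)), u x = w ‖x‖) ∧
        (∀ r ∈ Icc (1 / 2 : ℝ) 1, |w r| ≤ C * h1Norm (annulus N) u) ∧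
        ∀ R s : ℝ, 0 < R → R ≤ 1 / 2 → s ∈ Icc (R / 2) R →
          |w R - w s| ≤ C * h1Norm (annulus N) u * R ^ gammaExp N α := by
  have := nontrivial_euclideanSpace (N := N) (by omega)
  obtain ⟨C, hC, hosc⟩ := exists_oscillation_bound hN hα
  set σ := sphereArea (volume : Measure (EuclideanSpace ℝ (Fin N)))
  have hσ : 0 < σ := sphereArea_pos _
  -- Integrals over the annulus carry the area `σ` of the sphere, so the radial bound is applied
  -- with `M = ‖u‖ / √σ`.
  refine ⟨C / √σ, by positivity, fun f u hf hu hrad hsol hst => ?_⟩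
  obtain ⟨w, p, hw, hwu, hle⟩ := exists_isRadialSolution (by omega) hf.continuous hu hrad hsol
  have h := hosc f w p hf hw (fun ψ hψ hs => hst.integral_radial_nonneg hwu hψ hs)
    (h1Norm (annulus N) u / √σ) (div_nonneg (h1Norm_nonneg _ _) (Real.sqrt_nonneg _)) (by
      rw [div_pow, Real.sq_sqrt hσ.le, le_div_iff₀ hσ, mul_comm]
      exact hle)
  rw [← mul_div_assoc, ← div_mul_eq_mul_div] at h
  exact ⟨w, hw.continuousOn, hwu, h⟩

theorem eLpNorm_top_le_of_radial {N : ℕ} [Nontrivial (EuclideanSpace ℝ (Fin N))]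
    {u : EuclideanSpace ℝ (Fin N) → ℝ} {w : ℝ → ℝ} {K : ℝ}
    (hwu : ∀ᵐ x ∂(volume.restrict (unitBall N)), u x = w ‖x‖)
    (hw : ∀ r ∈ Ioc (0 : ℝ) 1, |w r| ≤ K) :
    eLpNorm u ⊤ (volume.restrict (unitBall N)) ≤ ENNReal.ofReal K := by
  rw [eLpNorm_exponent_top]
  refine eLpNormEssSup_le_of_ae_bound ?_
  rw [restrict_unitBall] at hwu ⊢
  filter_upwards [hwu, ae_restrict_mem (measurable_norm measurableSet_Ioo)] with x hx hxm
  rw [hx, Real.norm_eq_abs]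
  exact hw _ (Ioo_subset_Ioc_self hxm)

end HardyHenon

theorem theorem4p1 (N : ℕ) (hN : 2 ≤ N) (α : ℝ) (hα : -2 < α) :
    ∃ C : ℝ, 0 < C ∧
      ∀ (f : ℝ → ℝ) (u : EuclideanSpace ℝ (Fin N) → ℝ), ContDiff ℝ 1 f →
        HardyHenon.MemH1 (HardyHenon.unitBall N) u → HardyHenon.IsRadial u →
        HardyHenon.IsWeakSolution α f u → HardyHenon.IsStable α f u →
        -- `w` is the continuous representative of `u` as a function of `r = |x| ∈ (0, 1]`
        ∃ w : ℝ → ℝ, ContinuousOn w (Set.Ioc 0 1) ∧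
          (∀ᵐ x ∂(MeasureTheory.volume.restrict (HardyHenon.unitBall N)), u x = w ‖x‖) ∧
          ((N : ℝ) < 10 + 4 * α →
            MeasureTheory.eLpNorm u ⊤ (MeasureTheory.volume.restrict (HardyHenon.unitBall N)) ≤
              ENNReal.ofReal (C * HardyHenon.h1Norm (HardyHenon.annulus N) u)) ∧
          ((N : ℝ) = 10 + 4 * α →
            ∀ r ∈ Set.Ioc (0 : ℝ) 1,
              |w r| ≤ C * HardyHenon.h1Norm (HardyHenon.annulus N) u * (|Real.log r| + 1)) ∧
          (10 + 4 * α < (N : ℝ) →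
            ∀ r ∈ Set.Ioc (0 : ℝ) 1,
              |w r| ≤ C * HardyHenon.h1Norm (HardyHenon.annulus N) u *
                r ^ HardyHenon.gammaExp N α) := by
  have := HardyHenon.nontrivial_euclideanSpace (N := N) (by omega)
  obtain ⟨C, hC, hprof⟩ := HardyHenon.exists_profile_bounds hN hα
  -- The regime is fixed by `N` and `α`, so the constant may be chosen per case, before `f` and `u`.
  rcases lt_trichotomy (N : ℝ) (10 + 4 * α) with h | h | h
  · obtain ⟨D, hD, hdy⟩ :=
      HardyHenon.exists_dyadic_bound_of_pos (HardyHenon.gammaExp_pos hN hα h)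
    refine ⟨C * D, by positivity, fun f u hf hu hrad hsol hst => ?_⟩
    obtain ⟨w, hwc, hwu, h1, h2⟩ := hprof f u hf hu hrad hsol hst
    refine ⟨w, hwc, hwu, fun _ => HardyHenon.eLpNorm_top_le_of_radial hwu fun r hr => ?_,
      fun h' => absurd h' h.ne, fun h' => absurd h' h.not_gt⟩
    exact (hdy w _ h1 h2 r hr).trans (le_of_eq (by ring))
  · obtain ⟨D, hD, hdy⟩ := HardyHenon.exists_dyadic_bound_of_eq_zero
    refine ⟨C * D, by positivity, fun f u hf hu hrad hsol hst => ?_⟩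
    obtain ⟨w, hwc, hwu, h1, h2⟩ := hprof f u hf hu hrad hsol hst
    rw [HardyHenon.gammaExp_eq_zero hα h] at h2
    refine ⟨w, hwc, hwu, fun h' => absurd h h'.ne, fun _ r hr => ?_,
      fun h' => absurd h h'.ne'⟩
    exact (hdy w _ h1 h2 r hr).trans (le_of_eq (by ring))
  · obtain ⟨D, hD, hdy⟩ :=
      HardyHenon.exists_dyadic_bound_of_neg (HardyHenon.gammaExp_neg hα h)
    refine ⟨C * D, by positivity, fun f u hf hu hrad hsol hst => ?_⟩
    obtain ⟨w, hwc, hwu, h1, h2⟩ := hprof f u hf hu hrad hsol hst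
    refine ⟨w, hwc, hwu, fun h' => absurd h' h.not_gt, fun h' => absurd h' h.ne',
      fun _ r hr => ?_⟩
    exact (hdy w _ h1 h2 r hr).trans (le_of_eq (by ring))
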